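/- **Model.** A base station with $M$ antennas serves $K = T K_B$ single-antenna users ($T, K_B \ge 1$) in $T$ resource blocks of $K_B$ users each (one round-robin period). The channels $\mathbf g_k \in \mathbb C^{1\times M}$, $1\le k\le K$, are independent with law $\mathcal{CN}(\mathbf 0,\beta \mathbf I_M)$, $\beta>0$. Let $\mathbf F$ be the reported channel matrix of the users of a block and $\mathbf G$ their true one. The base station uses zero forcing $\mathbf W=\mathbf F^H(\mathbf F\mathbf F^H)^{-1}$ with normalization $d_k = 1/\|\mathbf w_k\|$, and max-min power control with total power $P>0$: the powers $P_k$ satisfy $\sum_k P_k=P$ and $P_kd_k^2$ does not depend on $k$. The rate of user $k$ is $\log_2(1+\mathrm{SINR}_k)$, computed from the received signal $\mathbf G\mathbf W\,\mathrm{diag}(d_k)\,\mathrm{diag}(\sqrt{P_k})\,\mathbf s+\mathbf n$ with unit-variance symbols $\mathbf s$ and noise variance $\sigma_n^2>0$. Magnitude-based grouping (CM) puts the $K_B$ users with the largest reported $\|\mathbf f_k\|^2$ into block 1, the next $K_B$ into block 2, and so on; random grouping (rand) uses a uniformly random order independent of the channels. With accurate reporting $\mathbf f_k=\mathbf g_k$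 for all users. With misreporting, users $1,\dots,K_M$ ($0\le K_M\le K_B$, $K_M<K$) report $\mathbf f_k=\sqrt\delta\,\mathbf g_k$ with a fixed $\delta\in(0,1)$, and the other (honest) users report $\mathbf f_k = \mathbf g_k$. Let $R_t^{a,CM}$ and $R_t^{a,rand}$ be the expected average rate of the users of block $t$ with accurate reporting, under the two groupings, and let $R_t^{m,CM}$ be the expected average rate of the honest users of block $t$ with misreporting (the average is read as $0$ if a block contains no honest user). Put $$R^{a,CM}=\frac1K\sum_{t=1}^T K_BR_t^{a,CM},\qquad R^{a,rand}=\frac1K\sum_{t=1}^T K_BR_t^{a,rand},$$ $$R^{m,CM}=\frac{(K_B-K_M)R_T^{m,CM}+\sum_{t=1}^{T-1}K_BR_t^{m,CM}}{K-K_M},\qquad \theta^{CM}=\frac{R^{a,CM}-R^{m,CM}}{R^{a,CM}}.$$ For numbers $r,a,m$ let $$\Theta(r,a,m)=-\frac{K_M(T-1)}{T(K-K_M)}+\frac{a}{T\,r}-\frac{(K_B-K_M)\,m}{(K-K_M)\,r}.$$ Let $f_{(k)}$ and $\bar f_{(k)}$ be the probability density functions of the $k$-th smallest order statistic of a sample of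 size $K$ and $K-K_M$, respectively, from the gamma distribution with shape $M$ and scale $\beta$, and put $$A_T^a=\sum_{k=1}^{K_B}\int_0^\infty\frac{f_{(k)}(x)}{x}\,dx,\qquad A_T^m=\frac{K_M}{\delta\beta(M-1)}+\sum_{k=1}^{K_B-K_M}\int_0^\infty\frac{\bar f_{(k)}(x)}{x}\,dx,$$ $$L^{rand}=\log_2\Big(1+\frac{P\beta}{\sigma_n^2}\frac{M-K_B}{K_B}\Big),\quad L^a=\log_2\Big(1+\frac{P}{\sigma_n^2}\frac{M-K_B}{(M-1)A_T^a}\Big),\quad L^m=\log_2\Big(1+\frac{P}{\sigma_n^2}\frac{M-K_B}{(M-1)A_T^m}\Big).$$ **Claim.** As $M\to\infty$ with all other parameters fixed: 1. $\theta^{CM}-\Theta(R^{a,rand},R_T^{a,CM},R_T^{m,CM})\to0$ and $\theta^{CM}-\Theta(L^{rand},L^a,L^m)\to0$. If moreover $1\le K_M<K_B$, then also $\theta^{CM}\sim\Theta(R^{a,rand},R_T^{a,CM},R_T^{m,CM})$ and $\theta^{CM}\sim\Theta(L^{rand},L^a,L^m)$, i.e. both hold with vanishing relative error. 2. $R^{a,rand}-L^{rand}\to0$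 and $R_T^{a,CM}-L^a\to0$; and, if $K_M<K_B$, $R_T^{m,CM}-L^m\to0$. -/

import Mathlib

open MeasureTheory ProbabilityTheory Filter Topology Asymptotics
open scoped Nat

noncomputable section

namespace MassiveMIMO

/-! ### Channel law -/

/-- The circularly symmetric complex Gaussian law `CN(0, β)` on `ℂ`: real and imaginary parts are
independent, each `N(0, β / 2)`. -/
def complexGaussian (β : ℝ) : Measure ℂ :=
  Measure.map (fun p : ℝ × ℝ => (⟨p.1, p.2⟩ : ℂ))
    ((gaussianReal 0 (β / 2).toNNReal).prod (gaussianReal 0 (β / 2).toNNReal))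

/-- Joint law of the channels `g_1, …, g_K` of `K` homogeneous users to `M` antennas:
independent rows `g_k ∼ CN(0, β I_M)`, i.e. all entries are i.i.d. `CN(0, β)`. -/
def channelLaw (K M : ℕ) (β : ℝ) : Measure (Fin K → Fin M → ℂ) :=
  Measure.pi fun _ => Measure.pi fun _ => complexGaussian β

/-- Channel magnitude `X_k = ‖g_k‖²` (squared Euclidean norm of the `k`-th row). -/
def channelMagnitude {K M : ℕ} (G : Matrix (Fin K) (Fin M) ℂ) (k : Fin K) : ℝ :=
  ∑ i, ‖G k i‖ ^ 2

/-! ### Zero-forcing precoding and max-min power control in one resource block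

`F` is the CSI of the `n` users of the block that is known to the BS, `G` is the true channel. -/

/-- `W = Fᴴ (F Fᴴ)⁻¹`. -/
def zfPrecoder {n M : ℕ} (F : Matrix (Fin n) (Fin M) ℂ) : Matrix (Fin M) (Fin n) ℂ :=
  F.conjTranspose * (F * F.conjTranspose)⁻¹

/-- `d_k = 1 / ‖w_k‖`, with `w_k` the `k`-th column of `W`. -/
def beamScale {n M : ℕ} (F : Matrix (Fin n) (Fin M) ℂ) (k : Fin n) : ℝ :=
  1 / Real.sqrt (∑ i, ‖zfPrecoder F i k‖ ^ 2)

/-- Max-min power control: the powers `P_k` with `P_k d_k²` independent of `k` and total `P`. -/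
def maxMinPower {n M : ℕ} (P : ℝ) (F : Matrix (Fin n) (Fin M) ℂ) (k : Fin n) : ℝ :=
  P * (1 / beamScale F k ^ 2) / ∑ j, 1 / beamScale F j ^ 2

/-- The matrix `G W D P` that maps the source symbols `s` to the noiseless received signals when
the BS precodes and allocates power according to `F` while the true channel is `G`. -/
def effectiveChannel {n M : ℕ} (P : ℝ) (F G : Matrix (Fin n) (Fin M) ℂ) :
    Matrix (Fin n) (Fin n) ℂ :=
  G * zfPrecoder F * Matrix.diagonal (fun k => (beamScale F k : ℂ)) *
    Matrix.diagonal (fun k => (Real.sqrt (maxMinPower P F k) : ℂ))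

/-- Signal-to-interference-plus-noise ratio actually received by user `k`; unit-variance symbols,
noise variance `σ²`. -/
def receivedSINR {n M : ℕ} (P σ : ℝ) (F G : Matrix (Fin n) (Fin M) ℂ) (k : Fin n) : ℝ :=
  ‖effectiveChannel P F G k k‖ ^ 2 /
    (σ ^ 2 + ∑ j ∈ Finset.univ.erase k, ‖effectiveChannel P F G k j‖ ^ 2)

/-- Instantaneous rate of user `k`. -/
def userRate {n M : ℕ} (P σ : ℝ) (F G : Matrix (Fin n) (Fin M) ℂ) (k : Fin n) : ℝ :=
  Real.logb 2 (1 + receivedSINR P σ F G k)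

/-! ### Round-robin scheduling: `K = T * KB` users, `T` blocks of `KB` users -/

/-- Users served in block `t` when the users are served in the order `π`. -/
def blockUsers {T KB : ℕ} (π : Equiv.Perm (Fin (T * KB))) (t : Fin T) (j : Fin KB) :
    Fin (T * KB) :=
  π (finProdFinEquiv (t, j))

/-- Channel-magnitude-based order: users sorted by decreasing magnitude of the reported CSI `F`. -/
def magnitudeOrder {K M : ℕ} (F : Matrix (Fin K) (Fin M) ℂ) : Equiv.Perm (Fin K) :=
  Tuple.sort fun k => -channelMagnitude F k

/-- Instantaneous per-user rate, averaged over those of the users `S 0, …, S (KB - 1)` served in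
one block that belong to `H`; `F` is the CSI reported to the BS and `G` the true channel. -/
def groupRate {K KB M : ℕ} (P σ : ℝ) (F G : Matrix (Fin K) (Fin M) ℂ)
    (H : Finset (Fin K)) (S : Fin KB → Fin K) : ℝ :=
  (∑ j with S j ∈ H, userRate P σ (F.submatrix S id) (G.submatrix S id) j) /
    (Finset.univ.filter fun j => S j ∈ H).card

/-- The honest users: all but the first `KM`. -/
def honestUsers (K KM : ℕ) : Finset (Fin K) :=
  Finset.univ.filter fun k => KM ≤ (k : ℕ)

/-- Reported CSI `F = Δ^{1/2} G`: the first `KM` users scale their channel magnitude by `δ`. -/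
def reportedCSI {K M : ℕ} (KM : ℕ) (δ : ℝ) (G : Matrix (Fin K) (Fin M) ℂ) :
    Matrix (Fin K) (Fin M) ℂ :=
  Matrix.diagonal (fun k : Fin K => ((if (k : ℕ) < KM then Real.sqrt δ else 1 : ℝ) : ℂ)) * G

/-- `R_t^{a,CM}`: ergodic per-user rate in block `t`, magnitude-based grouping, accurate CSI. -/
def rateAccCM (T KB M : ℕ) (β P σ : ℝ) (t : Fin T) : ℝ :=
  ∫ G, groupRate P σ (Matrix.of G) (Matrix.of G) Finset.univ
    (blockUsers (magnitudeOrder (Matrix.of G)) t) ∂(channelLaw (T * KB) M β)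

/-- `R_t^{m,CM}`: ergodic per-user rate of the honest users in block `t`, magnitude-based grouping,
with `KM` users underreporting by the factor `δ`. Grouping, precoding and power allocation all use
the reported CSI. -/
def rateMisCM (T KB KM M : ℕ) (β P σ δ : ℝ) (t : Fin T) : ℝ :=
  ∫ G, groupRate P σ (reportedCSI KM δ (Matrix.of G)) (Matrix.of G) (honestUsers (T * KB) KM)
    (blockUsers (magnitudeOrder (reportedCSI KM δ (Matrix.of G))) t) ∂(channelLaw (T * KB) M β)

/-- `R_t^{a,rand}`: ergodic per-user rate in block `t`, accurate CSI, uniformly random grouping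
that is independent of the channels. -/
def rateAccRandBlock (T KB M : ℕ) (β P σ : ℝ) (t : Fin T) : ℝ :=
  (∑ π : Equiv.Perm (Fin (T * KB)),
    ∫ G, groupRate P σ (Matrix.of G) (Matrix.of G) Finset.univ (blockUsers π t)
      ∂(channelLaw (T * KB) M β)) / ((T * KB)! : ℝ)

/-- `R^{a,rand}`: per-user rate over one scheduling period, random grouping, accurate CSI. -/
def rateAccRand (T KB M : ℕ) (β P σ : ℝ) : ℝ :=
  (1 / ((T * KB : ℕ) : ℝ)) * ∑ t : Fin T, (KB : ℝ) * rateAccRandBlock T KB M β P σ t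

/-- `R^{a,CM}`: per-user rate over one scheduling period, accurate CSI. -/
def periodRateAccCM (T KB M : ℕ) (β P σ : ℝ) : ℝ :=
  (1 / ((T * KB : ℕ) : ℝ)) * ∑ t : Fin T, (KB : ℝ) * rateAccCM T KB M β P σ t

/-- `R^{m,CM}`: per-user rate of honest users over one scheduling period with misreporting;
`⊤ : Fin T` is the last block. -/
def periodRateMisCM (T KB KM M : ℕ) [NeZero T] (β P σ δ : ℝ) : ℝ :=
  (((KB : ℝ) - KM) * rateMisCM T KB KM M β P σ δ ⊤ +
      ∑ t ∈ Finset.univ.erase (⊤ : Fin T), (KB : ℝ) * rateMisCM T KB KM M β P σ δ t) /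
    (((T * KB : ℕ) : ℝ) - KM)

/-- `θ^{CM}`: fraction of their rate that honest users lose. -/
def rateLossCM (T KB KM M : ℕ) [NeZero T] (β P σ δ : ℝ) : ℝ :=
  (periodRateAccCM T KB M β P σ - periodRateMisCM T KB KM M β P σ δ) /
    periodRateAccCM T KB M β P σ

/-! ### Gamma order statistics and the asymptotic expressions -/

/-- The `k`-th smallest entry of `x` (`k` counted from `0`). -/
def orderStat {n : ℕ} (k : Fin n) (x : Fin n → ℝ) : ℝ :=
  x (Tuple.sort x k)

/-- Probability density function of the `k`-th smallest order statistic (`k` counted from `0`) of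
`n` i.i.d. samples of the gamma law with shape `M` and scale `β` (i.e. rate `1 / β`). -/
def gammaOrderStatPDF (M : ℕ) (β : ℝ) {n : ℕ} (k : Fin n) (x : ℝ) : ℝ :=
  (pdf (orderStat k) (Measure.pi fun _ : Fin n => gammaMeasure (M : ℝ) (1 / β)) volume x).toReal

/-- `∑_{k=1}^{m} ∫_0^∞ f_(k)(x) / x dx` for samples of size `n`, where `m ≤ n`. -/
def orderStatSum (M : ℕ) (β : ℝ) (n m : ℕ) : ℝ :=
  ∑ k ∈ Finset.univ.filter (fun k : Fin n => (k : ℕ) < m),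
    ∫ x in Set.Ioi (0 : ℝ), gammaOrderStatPDF M β k x / x

/-- `A_T^a`. -/
def coeffAcc (T KB M : ℕ) (β : ℝ) : ℝ :=
  orderStatSum M β (T * KB) KB

/-- `A_T^m`. -/
def coeffMis (T KB KM M : ℕ) (β δ : ℝ) : ℝ :=
  (KM : ℝ) / (δ * β * ((M : ℝ) - 1)) + orderStatSum M β (T * KB - KM) (KB - KM)

/-- Asymptotic expression of `R^{a,rand}`. -/
def asympRand (KB M : ℕ) (β P σ : ℝ) : ℝ :=
  Real.logb 2 (1 + P * β / σ ^ 2 * (((M : ℝ) - KB) / KB))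

/-- Asymptotic expression of the last-block rates in terms of the coefficient `A`. -/
def asympLast (KB M : ℕ) (P σ A : ℝ) : ℝ :=
  Real.logb 2 (1 + P / σ ^ 2 * (((M : ℝ) - KB) / (((M : ℝ) - 1) * A)))

/-- `-K_M (T-1) / (T (K-K_M)) + a / (T r) - (K_B-K_M) m / ((K-K_M) r)`, with `K = T K_B`. -/
def lossForm (T KB KM : ℕ) (r a m : ℝ) : ℝ :=
  -((KM : ℝ) * ((T : ℝ) - 1) / (T * (((T * KB : ℕ) : ℝ) - KM))) + a / (T * r) -
    ((KB : ℝ) - KM) * m / ((((T * KB : ℕ) : ℝ) - KM) * r)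

end MassiveMIMO

end

/-!
With `M` antennas every rate in the statement is `log₂ M + const + o(1)`, so all rate differences
converge while the denominator of the rate loss grows like `log₂ M`.

Deterministic part. Zero forcing removes the interference even under misreporting, because a report
only rescales rows of the channel; an honest user of block `S` has the SINR
`P / (σ² tr (F_S F_Sᴴ)⁻¹)` (`receivedSINR_eq`). If `G Gᴴ / M` is close to `β I`, continuity of the
matrix inverse gives the rate `log₂ M + log₂ (P β / (σ² s)) + o(1)`, where the load `s` of the block
is `∑ 1 / δ_k` over its users, with `δ_k` the power scaling of the report of user `k`
(`exists_userRate_near`). In the same regime the misreporting users have the smallest reported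
magnitudes, hence all of them are served last (`magnitudeOrder_mem_honestUsers_iff`): the last block
has load `K_M / δ + (K_B - K_M)` and every other block has load `K_B`.

Probabilistic part. The mean of the squared deviation `‖G Gᴴ / M - β I‖²` is `O(1 / M)`
(`exists_integral_gramDev_eq`). Where the deviation is not small, a block rate still lies between `0`
and `log₂ M + O(1 + deviation)`: by Cauchy–Schwarz, `f_k w_k = 1` bounds the SINR by the
interference-free one. Both regimes combine into a pointwise error bound
`ε + C (log₂ M + 1) · deviation` (`exists_abs_groupRate_sub_le`), and `log₂ M / M → 0` yields the limit
of the expectations (`tendsto_integral_groupRate`). No almost sure invertibility is needed: a singular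
Gram matrix gives rate `0`, within these bounds.

Closed forms. For `X` gamma distributed with shape `M` and scale `β`, the first two moments of `1 / X`
give `E |M / X - 1 / β| → 0`; the same holds for an order statistic, since a nonnegative function of it
is at most the sum of that function over the sample. Hence `M A_T` converges
(`tendsto_mul_orderStatSum`).

Finally, the coefficients of `lossForm` sum to zero (`lossForm_eq`), so `log₂ M` times it, and `log₂ M`
times the rate loss, converge to the same constant. For `1 ≤ K_M < K_B` this constant is nonzero, which
turns the common limit into asymptotic equivalence.
-/

noncomputable section

namespace MassiveMIMO

open Matrix

/-! ### Zero forcing and max-min power control in one block -/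

section ZeroForcing

variable {n M : ℕ} {F G : Matrix (Fin n) (Fin M) ℂ} {P σ : ℝ}

lemma mul_zfPrecoder (h : IsUnit (F * F.conjTranspose).det) : F * zfPrecoder F = 1 := by
  rw [zfPrecoder, ← Matrix.mul_assoc, Matrix.mul_nonsing_inv _ h]

lemma zfPrecoder_eq_zero (h : ¬ IsUnit (F * F.conjTranspose).det) : zfPrecoder F = 0 := by
  rw [zfPrecoder, Matrix.nonsing_inv_apply_not_isUnit _ h, Matrix.mul_zero]

/-- The total squared norm of the zero-forcing columns is the trace of the inverse Gram matrix. -/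
lemma sum_norm_sq_zfPrecoder (h : IsUnit (F * F.conjTranspose).det) :
    ∑ j, ∑ i, ‖zfPrecoder F i j‖ ^ 2 = ((F * F.conjTranspose)⁻¹).trace.re := by
  have hW : (zfPrecoder F).conjTranspose * zfPrecoder F = (F * F.conjTranspose)⁻¹ := by
    have h1 : (zfPrecoder F).conjTranspose * F.conjTranspose = 1 := by
      rw [← Matrix.conjTranspose_mul, mul_zfPrecoder h, Matrix.conjTranspose_one]
    rw [show (zfPrecoder F).conjTranspose * zfPrecoder F = ((zfPrecoder F).conjTranspose *
      F.conjTranspose) * (F * F.conjTranspose)⁻¹ by rw [Matrix.mul_assoc]; rfl, h1,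
      Matrix.one_mul]
  rw [← hW, Matrix.trace, Complex.re_sum]
  refine Finset.sum_congr rfl fun j _ => ?_
  rw [Matrix.diag_apply, Matrix.mul_apply, Complex.re_sum]
  refine Finset.sum_congr rfl fun i _ => ?_
  rw [Matrix.conjTranspose_apply, Complex.star_def, Complex.conj_mul', ← Complex.ofReal_pow,
    Complex.ofReal_re]

/-- Cauchy–Schwarz applied to `f_k w_k = 1`. -/
lemma one_le_norm_sq_mul_zfPrecoder (h : IsUnit (F * F.conjTranspose).det) (k : Fin n) :
    1 ≤ channelMagnitude F k * ∑ i, ‖zfPrecoder F i k‖ ^ 2 := by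
  have h1 : ∑ i, F k i * zfPrecoder F i k = 1 := by
    rw [← Matrix.mul_apply, mul_zfPrecoder h, Matrix.one_apply_eq]
  have h2 : (1 : ℝ) ≤ ∑ i, ‖F k i‖ * ‖zfPrecoder F i k‖ := by
    calc (1 : ℝ) = ‖∑ i, F k i * zfPrecoder F i k‖ := by rw [h1, norm_one]
      _ ≤ ∑ i, ‖F k i * zfPrecoder F i k‖ := norm_sum_le _ _
      _ = _ := by simp only [norm_mul]
  calc (1 : ℝ) ≤ (∑ i, ‖F k i‖ * ‖zfPrecoder F i k‖) ^ 2 := by nlinarith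
    _ ≤ _ := Finset.sum_mul_sq_le_sq_mul_sq _ _ _

lemma receivedSINR_nonneg (k : Fin n) : 0 ≤ receivedSINR P σ F G k := by
  unfold receivedSINR; positivity

lemma userRate_nonneg (k : Fin n) : 0 ≤ userRate P σ F G k :=
  Real.logb_nonneg one_lt_two (by linarith [receivedSINR_nonneg (P := P) (σ := σ) (F := F) (G := G) k])

/-- If the reported channel is a row scaling of the true one, then zero forcing removes all
interference, and max-min power control gives a user with accurate report the SINR
`P / (σ² tr (F Fᴴ)⁻¹)`. -/
lemma receivedSINR_eq (hP : 0 < P) {D : Fin n → ℂ} (hF : F = diagonal D * G)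
    (h : IsUnit (F * F.conjTranspose).det) {k : Fin n} (hk : D k = 1) :
    receivedSINR P σ F G k = P / (∑ j, ∑ i, ‖zfPrecoder F i j‖ ^ 2) / σ ^ 2 := by
  have hGW : ∀ j, (G * zfPrecoder F) k j = (1 : Matrix (Fin n) (Fin n) ℂ) k j := by
    intro j
    rw [← mul_zfPrecoder h, hF, Matrix.mul_assoc, Matrix.diagonal_mul, hk, one_mul]
  have heff : ∀ j, effectiveChannel P F G k j = (1 : Matrix (Fin n) (Fin n) ℂ) k j *
      (beamScale F j : ℂ) * (Real.sqrt (maxMinPower P F j) : ℂ) := by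
    intro j
    rw [effectiveChannel, Matrix.mul_diagonal, Matrix.mul_diagonal, hGW]
  have hint : ∑ j ∈ Finset.univ.erase k, ‖effectiveChannel P F G k j‖ ^ 2 = 0 := by
    refine Finset.sum_eq_zero fun j hj => ?_
    rw [heff, Matrix.one_apply_ne (Finset.ne_of_mem_erase hj).symm]
    simp
  have hpos : 0 < ∑ i, ‖zfPrecoder F i k‖ ^ 2 := by
    have h1 := one_le_norm_sq_mul_zfPrecoder h k
    have h2 : 0 ≤ ∑ i, ‖zfPrecoder F i k‖ ^ 2 := by positivity
    rcases h2.eq_or_lt with h3 | h3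
    · rw [← h3, mul_zero] at h1; linarith
    · exact h3
  have hb : ∀ j, 1 / beamScale F j ^ 2 = ∑ i, ‖zfPrecoder F i j‖ ^ 2 := by
    intro j
    rw [beamScale, div_pow, one_pow, one_div_one_div, Real.sq_sqrt (by positivity)]
  have hb' : beamScale F k ^ 2 = 1 / ∑ i, ‖zfPrecoder F i k‖ ^ 2 := by
    rw [← hb, one_div_one_div]
  have hmm : maxMinPower P F k = P * (∑ i, ‖zfPrecoder F i k‖ ^ 2) /
      ∑ j, ∑ i, ‖zfPrecoder F i j‖ ^ 2 := by
    simp only [maxMinPower, hb]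
  have hmm0 : 0 ≤ maxMinPower P F k := by
    rw [hmm]
    exact div_nonneg (mul_nonneg hP.le hpos.le)
      (Finset.sum_nonneg fun j _ => Finset.sum_nonneg fun i _ => sq_nonneg _)
  rw [receivedSINR, hint, add_zero, heff, Matrix.one_apply_eq, one_mul, norm_mul, mul_pow,
    Complex.norm_real, Complex.norm_real, Real.norm_eq_abs, Real.norm_eq_abs, sq_abs, sq_abs,
    Real.sq_sqrt hmm0, hb', hmm]
  generalize (∑ i, ‖zfPrecoder F i k‖ ^ 2) = a at hpos
  rw [← mul_div_assoc, mul_comm P a, ← mul_assoc, one_div_mul_cancel hpos.ne', one_mul]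

lemma receivedSINR_eq_zero (h : ¬ IsUnit (F * F.conjTranspose).det) (k : Fin n) :
    receivedSINR P σ F G k = 0 := by
  simp [receivedSINR, effectiveChannel, zfPrecoder_eq_zero h]

/-- The SINR of an accurately reporting user is at most the interference-free one. -/
lemma receivedSINR_le (hP : 0 < P) {D : Fin n → ℂ} (hF : F = diagonal D * G)
    {k : Fin n} (hk : D k = 1) :
    receivedSINR P σ F G k ≤ P / σ ^ 2 * channelMagnitude F k := by
  have hmag : 0 ≤ channelMagnitude F k := by unfold channelMagnitude; positivity
  by_cases h : IsUnit (F * F.conjTranspose).det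
  · rw [receivedSINR_eq hP hF h hk]
    have h1 := one_le_norm_sq_mul_zfPrecoder h k
    have h2 : ∑ i, ‖zfPrecoder F i k‖ ^ 2 ≤ ∑ j, ∑ i, ‖zfPrecoder F i j‖ ^ 2 :=
      Finset.single_le_sum (f := fun j => ∑ i, ‖zfPrecoder F i j‖ ^ 2)
        (fun j _ => by positivity) (Finset.mem_univ k)
    set s := ∑ j, ∑ i, ‖zfPrecoder F i j‖ ^ 2
    have h3 : 1 ≤ channelMagnitude F k * s := h1.trans (by gcongr)
    have hs : 0 < s := by
      by_contra hs
      nlinarith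
    rw [div_div, div_mul_eq_mul_div]
    rcases eq_or_ne σ 0 with rfl | hσ
    · simp
    have : 0 < σ ^ 2 := by positivity
    rw [div_le_div_iff₀ (by positivity) this]
    have := mul_le_mul_of_nonneg_left h3 (by positivity : 0 ≤ P * σ ^ 2)
    linarith
  · rw [receivedSINR_eq_zero h]; positivity

end ZeroForcing

/-! ### Scaled reports -/

/-- The amplitude factor applied by user `k` to its channel when reporting. -/
def reportScale (K KM : ℕ) (δ : ℝ) (k : Fin K) : ℂ :=
  ((if (k : ℕ) < KM then Real.sqrt δ else 1 : ℝ) : ℂ)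

/-- The normalized Gram matrix `G Gᴴ / M` of the true channels. -/
def normGram {K M : ℕ} (G : Matrix (Fin K) (Fin M) ℂ) : Matrix (Fin K) (Fin K) ℂ :=
  (M : ℂ)⁻¹ • (G * G.conjTranspose)

lemma reportScale_of_honest {K KM : ℕ} {δ : ℝ} {k : Fin K} (hk : k ∈ honestUsers K KM) :
    reportScale K KM δ k = 1 := by
  have : ¬ (k : ℕ) < KM := by simpa [honestUsers] using hk
  simp [reportScale, this]

lemma reportedCSI_submatrix {K M n KM : ℕ} {δ : ℝ} (G : Matrix (Fin K) (Fin M) ℂ)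
    (S : Fin n → Fin K) : (reportedCSI KM δ G).submatrix S id =
      diagonal (fun j => reportScale K KM δ (S j)) * G.submatrix S id := by
  ext i j
  simp only [submatrix_apply, id, Matrix.diagonal_mul, reportedCSI, reportScale]

/-- The normalized Gram matrix of the reported channels of the users `S`, as a function of the
normalized Gram matrix `A` of the true channels. -/
def blockGram {K n : ℕ} (KM : ℕ) (δ : ℝ) (S : Fin n → Fin K) (A : Matrix (Fin K) (Fin K) ℂ) :
    Matrix (Fin n) (Fin n) ℂ :=
  diagonal (fun j => reportScale K KM δ (S j)) * A.submatrix S S *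
    diagonal (fun j => reportScale K KM δ (S j))

lemma conjTranspose_diagonal_reportScale {K n KM : ℕ} {δ : ℝ} (S : Fin n → Fin K) :
    (diagonal (fun j => reportScale K KM δ (S j))).conjTranspose =
      diagonal (fun j => reportScale K KM δ (S j)) := by
  rw [diagonal_conjTranspose]
  congr 1
  ext j
  simp [reportScale]

lemma reported_mul_conjTranspose {K M n KM : ℕ} {δ : ℝ} (hM : M ≠ 0)
    (G : Matrix (Fin K) (Fin M) ℂ) (S : Fin n → Fin K) :
    (reportedCSI KM δ G).submatrix S id * ((reportedCSI KM δ G).submatrix S id).conjTranspose =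
      (M : ℂ) • blockGram KM δ S (normGram G) := by
  have h : (G * G.conjTranspose).submatrix S S =
      G.submatrix S id * (G.submatrix S id).conjTranspose := by
    rw [conjTranspose_submatrix]
    exact submatrix_mul _ _ S id S Function.bijective_id
  rw [reportedCSI_submatrix, conjTranspose_mul, conjTranspose_diagonal_reportScale, blockGram,
    normGram, submatrix_smul, Pi.smul_apply, Pi.smul_apply, h, Matrix.mul_smul, Matrix.smul_mul, smul_smul,
    mul_inv_cancel₀ (Nat.cast_ne_zero.2 hM), one_smul]
  simp only [Matrix.mul_assoc]

/-- Rate of an honest user in the block `S`, when the block Gram matrix is invertible. -/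
lemma userRate_reported_eq {K M n KM : ℕ} {P σ δ : ℝ} (hP : 0 < P) (hM : M ≠ 0)
    (G : Matrix (Fin K) (Fin M) ℂ) (S : Fin n → Fin K)
    (h : IsUnit (blockGram KM δ S (normGram G)).det) {j : Fin n}
    (hj : S j ∈ honestUsers K KM) :
    userRate P σ ((reportedCSI KM δ G).submatrix S id) (G.submatrix S id) j =
      Real.logb 2 (1 + M * (P / (blockGram KM δ S (normGram G))⁻¹.trace.re / σ ^ 2)) := by
  have hM' : (M : ℂ) ≠ 0 := Nat.cast_ne_zero.2 hM
  have hunit : IsUnit ((reportedCSI KM δ G).submatrix S id *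
      ((reportedCSI KM δ G).submatrix S id).conjTranspose).det := by
    rw [reported_mul_conjTranspose hM, det_smul]
    exact ((isUnit_iff_ne_zero.2 hM').pow _).mul h
  rw [userRate, receivedSINR_eq hP (reportedCSI_submatrix G S) hunit (reportScale_of_honest hj),
    sum_norm_sq_zfPrecoder hunit, reported_mul_conjTranspose hM]
  have hinv : ((M : ℂ) • blockGram KM δ S (normGram G))⁻¹ =
      (M : ℂ)⁻¹ • (blockGram KM δ S (normGram G))⁻¹ := by
    refine Matrix.inv_eq_left_inv ?_
    rw [Matrix.smul_mul, Matrix.mul_smul, smul_smul, inv_mul_cancel₀ hM', one_smul,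
      Matrix.nonsing_inv_mul _ h]
  have hre : ((M : ℂ)⁻¹ • (blockGram KM δ S (normGram G))⁻¹).trace.re =
      (M : ℝ)⁻¹ * (blockGram KM δ S (normGram G))⁻¹.trace.re := by
    rw [trace_smul, smul_eq_mul, ← Complex.ofReal_natCast, ← Complex.ofReal_inv,
      Complex.re_ofReal_mul]
  rw [hinv, hre]
  congr 2
  rw [← div_div, div_inv_eq_mul]
  ring

lemma channelMagnitude_eq {K M : ℕ} (hM : M ≠ 0) (G : Matrix (Fin K) (Fin M) ℂ) (k : Fin K) :
    channelMagnitude G k = M * (normGram G k k).re := by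
  have : (G * G.conjTranspose) k k = ((channelMagnitude G k : ℝ) : ℂ) := by
    rw [Matrix.mul_apply, channelMagnitude, Complex.ofReal_sum]
    refine Finset.sum_congr rfl fun i _ => ?_
    rw [conjTranspose_apply, Complex.star_def, Complex.mul_conj', Complex.ofReal_pow]
  rw [normGram, Matrix.smul_apply, this, smul_eq_mul, ← Complex.ofReal_natCast,
    ← Complex.ofReal_inv, Complex.re_ofReal_mul, Complex.ofReal_re, mul_inv_cancel_left₀]
  exact Nat.cast_ne_zero.2 hM

lemma channelMagnitude_reportedCSI {K M KM : ℕ} {δ : ℝ} (hδ : 0 < δ) (G : Matrix (Fin K) (Fin M) ℂ)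
    (k : Fin K) : channelMagnitude (reportedCSI KM δ G) k =
      (if (k : ℕ) < KM then δ else 1) * channelMagnitude G k := by
  simp only [channelMagnitude, reportedCSI, Matrix.diagonal_mul, norm_mul, mul_pow,
    ← Finset.mul_sum, Complex.norm_real, Real.norm_eq_abs, sq_abs]
  congr 1
  split_ifs
  · exact Real.sq_sqrt hδ.le
  · simp

lemma userRate_reported_le {K M n KM : ℕ} {P σ δ : ℝ} (hP : 0 < P) (hδ : 0 < δ) (hM : M ≠ 0)
    (G : Matrix (Fin K) (Fin M) ℂ) (S : Fin n → Fin K) {j : Fin n}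
    (hj : S j ∈ honestUsers K KM) :
    userRate P σ ((reportedCSI KM δ G).submatrix S id) (G.submatrix S id) j ≤
      Real.logb 2 (1 + M * (P / σ ^ 2 * (normGram G (S j) (S j)).re)) := by
  have h := receivedSINR_le (σ := σ) hP (reportedCSI_submatrix (KM := KM) (δ := δ) G S) (reportScale_of_honest hj)
  have h2 : channelMagnitude ((reportedCSI KM δ G).submatrix S id) j =
      M * (normGram G (S j) (S j)).re := by
    change channelMagnitude (reportedCSI KM δ G) (S j) = _
    have : ¬ ((S j : Fin K) : ℕ) < KM := by simpa [honestUsers] using hj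
    rw [channelMagnitude_reportedCSI hδ, if_neg this, one_mul, channelMagnitude_eq hM]
  rw [h2] at h
  refine Real.logb_le_logb_of_le one_lt_two ?_ ?_
  · linarith [receivedSINR_nonneg (P := P) (σ := σ) (F := (reportedCSI KM δ G).submatrix S id)
      (G := G.submatrix S id) j]
  · linarith

/-! ### The rate of a block when the Gram matrix is near its mean -/

/-- Squared Frobenius distance of `A` from the ideal Gram matrix `β I`. -/
def gramDev {K : ℕ} (β : ℝ) (A : Matrix (Fin K) (Fin K) ℂ) : ℝ :=
  ∑ k, ∑ l, ‖A k l - (diagonal fun _ => (β : ℂ)) k l‖ ^ 2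

lemma gramDev_nonneg {K : ℕ} (β : ℝ) (A : Matrix (Fin K) (Fin K) ℂ) : 0 ≤ gramDev β A := by
  unfold gramDev; positivity

lemma norm_sub_sq_le_gramDev {K : ℕ} (β : ℝ) (A : Matrix (Fin K) (Fin K) ℂ) (k l : Fin K) :
    ‖A k l - (diagonal fun _ => (β : ℂ)) k l‖ ^ 2 ≤ gramDev β A := by
  refine le_trans ?_ (Finset.single_le_sum
    (f := fun k => ∑ l, ‖A k l - (diagonal fun _ => (β : ℂ)) k l‖ ^ 2)
    (fun _ _ => by positivity) (Finset.mem_univ k))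
  exact Finset.single_le_sum (f := fun l => ‖A k l - (diagonal fun _ => (β : ℂ)) k l‖ ^ 2)
    (fun _ _ => by positivity) (Finset.mem_univ l)

lemma sub_re_sq_le_gramDev {K : ℕ} (β : ℝ) (A : Matrix (Fin K) (Fin K) ℂ) (k : Fin K) :
    ((A k k).re - β) ^ 2 ≤ gramDev β A := by
  refine le_trans ?_ (norm_sub_sq_le_gramDev β A k k)
  rw [diagonal_apply_eq]
  have h := Complex.abs_re_le_norm (A k k - (β : ℂ))
  rw [Complex.sub_re, Complex.ofReal_re] at h
  exact sq_le_sq.2 (by rwa [abs_norm])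

lemma exists_gramDev_lt_mem {K : ℕ} {β : ℝ} {s : Set (Matrix (Fin K) (Fin K) ℂ)}
    (hs : s ∈ 𝓝 (diagonal fun _ => (β : ℂ))) : ∃ η > 0, ∀ A, gramDev β A < η → A ∈ s := by
  obtain ⟨r, hr, hrs⟩ := (Metric.nhds_basis_ball (α := Fin K → Fin K → ℂ)).mem_iff.1 hs
  refine ⟨r ^ 2, by positivity, fun A hA => hrs ?_⟩
  refine (dist_pi_lt_iff hr).2 fun k => (dist_pi_lt_iff hr).2 fun l => ?_
  rw [dist_eq_norm]
  exact lt_of_pow_lt_pow_left₀ 2 hr.le ((norm_sub_sq_le_gramDev β A k l).trans_lt hA)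

/-- The sum `∑ 1 / δ_k` over the users of a block, where `δ_k` is the power scaling of the report
of user `k`. -/
def blockLoad {K n : ℕ} (KM : ℕ) (δ : ℝ) (S : Fin n → Fin K) : ℝ :=
  ∑ j, if (S j : ℕ) < KM then δ⁻¹ else 1

lemma blockLoad_pos {K n KM : ℕ} {δ : ℝ} (hn : 0 < n) (hδ : 0 < δ) (S : Fin n → Fin K) :
    0 < blockLoad KM δ S := by
  have : Nonempty (Fin n) := ⟨⟨0, hn⟩⟩
  refine Finset.sum_pos (fun j _ => ?_) Finset.univ_nonempty
  split_ifs <;> positivity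

lemma blockGram_diagonal {K n KM : ℕ} {δ : ℝ} (hδ : 0 < δ) {S : Fin n → Fin K}
    (hS : Function.Injective S) (β : ℝ) :
    blockGram KM δ S (diagonal fun _ => (β : ℂ)) =
      diagonal fun j => ((if (S j : ℕ) < KM then δ else 1 : ℝ) * β : ℂ) := by
  rw [blockGram, submatrix_diagonal _ _ hS, diagonal_mul_diagonal, diagonal_mul_diagonal]
  congr 1
  ext j
  simp only [reportScale, Function.comp]
  split_ifs
  · rw [mul_right_comm, ← Complex.ofReal_mul, Real.mul_self_sqrt hδ.le]
  · simp

lemma continuous_blockGram {K n KM : ℕ} {δ : ℝ} (S : Fin n → Fin K) :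
    Continuous (blockGram KM δ S) := by
  unfold blockGram; fun_prop

/-- Near `β I`, the block Gram matrix is invertible and the normalized rate is close to its limit. -/
lemma eventually_normRate_near {K n KM : ℕ} {P σ δ β : ℝ} (hn : 0 < n) (hP : 0 < P) (hσ : 0 < σ)
    (hδ : 0 < δ) (hβ : 0 < β) {S : Fin n → Fin K} (hS : Function.Injective S) {ε : ℝ}
    (hε : 0 < ε) :
    ∀ᶠ q : ℕ × Matrix (Fin K) (Fin K) ℂ in atTop ×ˢ 𝓝 (diagonal fun _ => (β : ℂ)),
      IsUnit (blockGram KM δ S q.2).det ∧ 0 < P / (blockGram KM δ S q.2)⁻¹.trace.re / σ ^ 2 ∧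
      |Real.logb 2 ((q.1 : ℝ)⁻¹ + P / (blockGram KM δ S q.2)⁻¹.trace.re / σ ^ 2) -
        Real.logb 2 (P * β / (σ ^ 2 * blockLoad KM δ S))| < ε := by
  set A₀ : Matrix (Fin K) (Fin K) ℂ := diagonal fun _ => (β : ℂ)
  have hs := blockLoad_pos (KM := KM) hn hδ S
  have hd : ∀ j, ((if (S j : ℕ) < KM then δ else 1 : ℝ) * β : ℂ) ≠ 0 := by
    intro j
    rw [← Complex.ofReal_mul, Complex.ofReal_ne_zero]
    split_ifs <;> positivity
  have hdet : (blockGram KM δ S A₀).det ≠ 0 := by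
    rw [blockGram_diagonal hδ hS, det_diagonal]
    exact Finset.prod_ne_zero_iff.2 fun j _ => hd j
  have htr : (blockGram KM δ S A₀)⁻¹.trace.re = blockLoad KM δ S / β := by
    have : (blockGram KM δ S A₀)⁻¹ =
        diagonal fun j => (((if (S j : ℕ) < KM then δ else 1 : ℝ) * β : ℂ))⁻¹ := by
      refine inv_eq_left_inv ?_
      rw [blockGram_diagonal hδ hS, diagonal_mul_diagonal, ← diagonal_one]
      congr 1
      ext j
      exact inv_mul_cancel₀ (hd j)
    rw [this, trace_diagonal, Complex.re_sum, blockLoad, Finset.sum_div]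
    refine Finset.sum_congr rfl fun j _ => ?_
    rw [← Complex.ofReal_mul, ← Complex.ofReal_inv, Complex.ofReal_re]
    split_ifs <;> field_simp
  have hc := continuous_blockGram (KM := KM) (δ := δ) S
  have h1 : ∀ᶠ A in 𝓝 A₀, (blockGram KM δ S A).det ≠ 0 :=
    (hc.matrix_det.tendsto A₀).eventually_ne hdet
  have h2 : Tendsto (fun A => (blockGram KM δ S A)⁻¹.trace.re) (𝓝 A₀)
      (𝓝 (blockLoad KM δ S / β)) := by
    rw [← htr]
    have : (fun A => (blockGram KM δ S A)⁻¹.trace.re) =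
        fun A => ((blockGram KM δ S A).det⁻¹ • (blockGram KM δ S A).adjugate).trace.re := by
      ext A
      rw [Matrix.inv_def, Ring.inverse_eq_inv']
    have hcont : ContinuousAt (fun A =>
        ((blockGram KM δ S A).det⁻¹ • (blockGram KM δ S A).adjugate).trace.re) A₀ := by
      refine Complex.continuous_re.continuousAt.comp ?_
      refine Continuous.continuousAt (f := Matrix.trace) (by fun_prop) |>.comp ?_
      exact (hc.matrix_det.continuousAt.inv₀ hdet).smul hc.matrix_adjugate.continuousAt
    have := this ▸ hcont
    exact this.tendsto
  have h3 : Tendsto (fun A => P / (blockGram KM δ S A)⁻¹.trace.re / σ ^ 2) (𝓝 A₀)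
      (𝓝 (P * β / (σ ^ 2 * blockLoad KM δ S))) := by
    have := ((tendsto_const_nhds (x := P)).div h2 (by positivity)).div_const (σ ^ 2)
    rw [show P * β / (σ ^ 2 * blockLoad KM δ S) = P / (blockLoad KM δ S / β) / σ ^ 2 by
      field_simp]
    exact this
  have hlim : 0 < P * β / (σ ^ 2 * blockLoad KM δ S) := by positivity
  have h4 : Tendsto (fun q : ℕ × Matrix (Fin K) (Fin K) ℂ => Real.logb 2 ((q.1 : ℝ)⁻¹ +
      P / (blockGram KM δ S q.2)⁻¹.trace.re / σ ^ 2)) (atTop ×ˢ 𝓝 A₀)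
      (𝓝 (Real.logb 2 (P * β / (σ ^ 2 * blockLoad KM δ S)))) := by
    have h5 : Tendsto (fun q : ℕ × Matrix (Fin K) (Fin K) ℂ => (q.1 : ℝ)⁻¹ +
        P / (blockGram KM δ S q.2)⁻¹.trace.re / σ ^ 2) (atTop ×ˢ 𝓝 A₀)
        (𝓝 (0 + P * β / (σ ^ 2 * blockLoad KM δ S))) :=
      (tendsto_inv_atTop_nhds_zero_nat.comp tendsto_fst).add (h3.comp tendsto_snd)
    rw [zero_add] at h5
    exact (Real.continuousAt_log hlim.ne').tendsto.comp h5 |>.div_const _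
  have h6 := h4 (Metric.ball_mem_nhds _ hε)
  filter_upwards [h6, tendsto_snd.eventually h1, tendsto_snd.eventually (h3.eventually_const_lt hlim)]
    with q ha hb hc
  exact ⟨isUnit_iff_ne_zero.2 hb, hc, ha⟩

lemma logb_one_add_natCast_mul {M : ℕ} (hM : M ≠ 0) {x : ℝ} (hx : 0 ≤ x) :
    Real.logb 2 (1 + M * x) = Real.logb 2 M + Real.logb 2 ((M : ℝ)⁻¹ + x) := by
  have : (0 : ℝ) < M := by positivity
  rw [← Real.logb_mul this.ne' (by positivity), mul_add, mul_inv_cancel₀ this.ne']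

/-- With `M` antennas and a well-conditioned Gram matrix, every honest user of an arbitrary block
has rate `log₂ M + log₂ (P β / (σ² s)) + o(1)`, with `s` the load of the block. -/
lemma exists_userRate_near {K n KM : ℕ} {P σ δ β : ℝ} (hn : 0 < n) (hP : 0 < P) (hσ : 0 < σ)
    (hδ : 0 < δ) (hβ : 0 < β) {ε : ℝ} (hε : 0 < ε) :
    ∃ η > 0, ∀ᶠ M : ℕ in atTop, ∀ G : Matrix (Fin K) (Fin M) ℂ, gramDev β (normGram G) < η →
      ∀ S : Fin n → Fin K, Function.Injective S → ∀ j, S j ∈ honestUsers K KM →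
        |userRate P σ ((reportedCSI KM δ G).submatrix S id) (G.submatrix S id) j - Real.logb 2 M -
          Real.logb 2 (P * β / (σ ^ 2 * blockLoad KM δ S))| < ε := by
  have h : ∀ᶠ q : ℕ × Matrix (Fin K) (Fin K) ℂ in atTop ×ˢ 𝓝 (diagonal fun _ => (β : ℂ)),
      ∀ S : Fin n → Fin K, Function.Injective S → 
      IsUnit (blockGram KM δ S q.2).det ∧ 0 < P / (blockGram KM δ S q.2)⁻¹.trace.re / σ ^ 2 ∧
      |Real.logb 2 ((q.1 : ℝ)⁻¹ + P / (blockGram KM δ S q.2)⁻¹.trace.re / σ ^ 2) -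
        Real.logb 2 (P * β / (σ ^ 2 * blockLoad KM δ S))| < ε :=
    eventually_all.2 fun S => by
      by_cases hS : Function.Injective S
      · exact (eventually_normRate_near hn hP hσ hδ hβ hS hε).mono fun q hq _ => hq
      · exact Eventually.of_forall fun q hq => absurd hq hS
  obtain ⟨p, hp, s, hs, hps⟩ := eventually_prod_iff.1 h
  obtain ⟨η, hη, hηs⟩ := exists_gramDev_lt_mem hs
  refine ⟨η, hη, ?_⟩
  filter_upwards [hp, eventually_ne_atTop 0] with M hM hM0 G hG S hS j hj
  obtain ⟨h1, h2, h3⟩ := hps hM (hηs _ hG) S hS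
  rw [userRate_reported_eq hP hM0 G S h1 hj, logb_one_add_natCast_mul hM0 h2.le, add_sub_cancel_left]
  exact h3

lemma groupRate_nonneg {K n M : ℕ} (P σ : ℝ) (F G : Matrix (Fin K) (Fin M) ℂ)
    (H : Finset (Fin K)) (S : Fin n → Fin K) : 0 ≤ groupRate P σ F G H S :=
  div_nonneg (Finset.sum_nonneg fun _ _ => userRate_nonneg _) (Nat.cast_nonneg _)

lemma groupRate_le {K n M : ℕ} {P σ : ℝ} {F G : Matrix (Fin K) (Fin M) ℂ}
    {H : Finset (Fin K)} {S : Fin n → Fin K} {b : ℝ} (hb : 0 ≤ b)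
    (h : ∀ j, S j ∈ H → userRate P σ (F.submatrix S id) (G.submatrix S id) j ≤ b) :
    groupRate P σ F G H S ≤ b := by
  refine div_le_of_le_mul₀ (Nat.cast_nonneg _) hb ?_
  rw [mul_comm, ← nsmul_eq_mul]
  exact Finset.sum_le_card_nsmul _ _ _ fun j hj => h j (Finset.mem_filter.1 hj).2

lemma abs_groupRate_sub_le {K n M : ℕ} {P σ : ℝ} {F G : Matrix (Fin K) (Fin M) ℂ}
    {H : Finset (Fin K)} {S : Fin n → Fin K} {c ε : ℝ} (hne : ∃ j, S j ∈ H)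
    (h : ∀ j, S j ∈ H → |userRate P σ (F.submatrix S id) (G.submatrix S id) j - c| ≤ ε) :
    |groupRate P σ F G H S - c| ≤ ε := by
  obtain ⟨j₀, hj₀⟩ := hne
  have hcard : (0 : ℝ) < (Finset.univ.filter fun j => S j ∈ H).card :=
    Nat.cast_pos.2 (Finset.card_pos.2 ⟨j₀, Finset.mem_filter.2 ⟨Finset.mem_univ _, hj₀⟩⟩)
  have h1 : groupRate P σ F G H S - c =
      (∑ j with S j ∈ H, (userRate P σ (F.submatrix S id) (G.submatrix S id) j - c)) /
        (Finset.univ.filter fun j => S j ∈ H).card := by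
    rw [groupRate, Finset.sum_sub_distrib, Finset.sum_const, nsmul_eq_mul, sub_div,
      mul_div_cancel_left₀ _ hcard.ne']
  rw [h1, abs_div, abs_of_pos hcard, div_le_iff₀ hcard, mul_comm, ← nsmul_eq_mul]
  exact (Finset.abs_sum_le_sum_abs _ _).trans
    (Finset.sum_le_card_nsmul _ _ _ fun j hj => h j (Finset.mem_filter.1 hj).2)

/-- Crude upper bound for the rate of a block of honest users. -/
lemma groupRate_reported_le {K n M KM : ℕ} {P σ δ β : ℝ} (hP : 0 < P) (hβ : 0 < β)
    (hδ : 0 < δ) (hM : M ≠ 0) (G : Matrix (Fin K) (Fin M) ℂ) (S : Fin n → Fin K) :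
    groupRate P σ (reportedCSI KM δ G) G (honestUsers K KM) S ≤
      Real.logb 2 M + P / σ ^ 2 / Real.log 2 * (β + 1 + gramDev β (normGram G)) := by
  have hM1 : (1 : ℝ) ≤ M := Nat.one_le_cast.2 (Nat.one_le_iff_ne_zero.2 hM)
  have hlog := Real.log_pos one_lt_two
  have hdev := gramDev_nonneg β (normGram G)
  refine groupRate_le ?_ fun j hj => (userRate_reported_le hP hδ hM G S hj).trans ?_
  · have := Real.logb_nonneg one_lt_two hM1
    positivity
  set x := (normGram G (S j) (S j)).re
  have hx0 : 0 ≤ x := by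
    have h1 := channelMagnitude_eq hM G (S j)
    have h2 : 0 ≤ channelMagnitude G (S j) := by unfold channelMagnitude; positivity
    exact nonneg_of_mul_nonneg_right (h1 ▸ h2) (by positivity)
  have hx : x ≤ β + 1 + gramDev β (normGram G) := by
    nlinarith [sub_re_sq_le_gramDev β (normGram G) (S j), sq_nonneg (x - β - 1)]
  have hc : 0 ≤ P / σ ^ 2 := by positivity
  rw [logb_one_add_natCast_mul hM (by positivity)]
  refine add_le_add_right ?_ _
  have h1 : 0 < (M : ℝ)⁻¹ + P / σ ^ 2 * x := by positivity
  have h2 := Real.log_le_sub_one_of_pos h1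
  have h3 : (M : ℝ)⁻¹ ≤ 1 := inv_le_one_of_one_le₀ hM1
  rw [Real.logb, div_mul_eq_mul_div (P / σ ^ 2)]
  refine div_le_div_of_nonneg_right ?_ hlog.le
  have := mul_le_mul_of_nonneg_left hx hc
  linarith

/-- Pointwise comparison of the block rate with its limit, with an error that is small in mean. -/
lemma exists_abs_groupRate_sub_le {K n KM : ℕ} {P σ δ β η₀ s : ℝ} (hn : 0 < n) (hP : 0 < P)
    (hσ : 0 < σ) (hδ : 0 < δ) (hβ : 0 < β) (hη₀ : 0 < η₀) {ε : ℝ} (hε : 0 < ε) :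
    ∃ C, ∀ᶠ M : ℕ in atTop, ∀ G : Matrix (Fin K) (Fin M) ℂ, ∀ S : Fin n → Fin K,
      Function.Injective S → (gramDev β (normGram G) < η₀ →
        (∃ j, S j ∈ honestUsers K KM) ∧ blockLoad KM δ S = s) →
      |groupRate P σ (reportedCSI KM δ G) G (honestUsers K KM) S - Real.logb 2 M -
        Real.logb 2 (P * β / (σ ^ 2 * s))| ≤
          ε + C * (Real.logb 2 M + 1) * gramDev β (normGram G) := by
  obtain ⟨η₁, hη₁, hev⟩ := exists_userRate_near (K := K) (KM := KM) hn hP hσ hδ hβ hε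
  set c := P / σ ^ 2 / Real.log 2 with hcdef
  set L := Real.logb 2 (P * β / (σ ^ 2 * s))
  have hlog := Real.log_pos one_lt_two
  have hc : 0 ≤ c := by positivity
  set η := min η₀ η₁
  have hη : 0 < η := lt_min hη₀ hη₁
  refine ⟨(1 + |L| + c * (β + 1)) / η + c, ?_⟩
  filter_upwards [hev, eventually_ne_atTop 0] with M hM hM0 G S hS hGS
  have hl : 0 ≤ Real.logb 2 (M : ℝ) :=
    Real.logb_nonneg one_lt_two (Nat.one_le_cast.2 (Nat.one_le_iff_ne_zero.2 hM0))
  have hdev := gramDev_nonneg β (normGram G)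
  set v := gramDev β (normGram G)
  set l := Real.logb 2 (M : ℝ)
  rcases lt_or_ge v η with h | h
  · obtain ⟨hne, hload⟩ := hGS (h.trans_le (min_le_left _ _))
    have := abs_groupRate_sub_le (P := P) (σ := σ) (F := reportedCSI KM δ G) (G := G)
      (c := l + L) (ε := ε) hne fun j hj => by
      rw [← sub_sub]
      have := (hM G (h.trans_le (min_le_right _ _)) S hS j hj).le
      rwa [hload] at this
    rw [sub_sub]
    refine this.trans ?_
    have : 0 ≤ ((1 + |L| + c * (β + 1)) / η + c) * (l + 1) * v := by positivity
    linarith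
  · have h0 := groupRate_nonneg P σ (reportedCSI KM δ G) G (honestUsers K KM) S
    have h1 := groupRate_reported_le (KM := KM) (σ := σ) hP hβ hδ hM0 G S
    rw [← hcdef] at h1
    have h2 : |groupRate P σ (reportedCSI KM δ G) G (honestUsers K KM) S - l - L| ≤
        (l + |L| + c * (β + 1)) + c * v := by
      rw [abs_le]
      constructor <;>
      nlinarith [abs_nonneg L, le_abs_self L, neg_abs_le L, mul_nonneg hc hdev, mul_nonneg hc hβ.le]
    have h3 : 1 ≤ v / η := (one_le_div hη).2 h
    have h4 : 0 ≤ |L| := abs_nonneg L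
    have h5 : l + |L| + c * (β + 1) ≤ (1 + |L| + c * (β + 1)) * (l + 1) := by
      nlinarith [mul_nonneg hl h4, mul_nonneg hl (mul_nonneg hc (by positivity : 0 ≤ β + 1))]
    have h6 : (1 + |L| + c * (β + 1)) * (l + 1) ≤
        (1 + |L| + c * (β + 1)) * (l + 1) * (v / η) := le_mul_of_one_le_right (by positivity) h3
    have h7 : ((1 + |L| + c * (β + 1)) / η + c) * (l + 1) * v =
        (1 + |L| + c * (β + 1)) * (l + 1) * (v / η) + c * v + c * v * l := by ring
    have h8 : 0 ≤ c * v * l := by positivity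
    linarith

/-! ### Where sorting puts the honest users -/

lemma card_honestUsers {K KM : ℕ} (h : KM ≤ K) : (honestUsers K KM).card = K - KM := by
  have h1 : honestUsers K KM = (Finset.univ.filter fun k : Fin K => (k : ℕ) < KM)ᶜ := by
    ext k; simp [honestUsers]
  rw [h1, Finset.card_compl, Fintype.card_fin, Fin.card_filter_val_lt, min_eq_right h]

/-- If all honest users report larger channels than all misreporting ones, then they occupy exactly
the first `K - KM` positions of the magnitude order. -/
lemma magnitudeOrder_mem_honestUsers_iff {K KM M : ℕ} (hK : KM ≤ K) {F : Matrix (Fin K) (Fin M) ℂ}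
    (h : ∀ k ∈ honestUsers K KM, ∀ l ∉ honestUsers K KM,
      channelMagnitude F l < channelMagnitude F k) (p : Fin K) :
    magnitudeOrder F p ∈ honestUsers K KM ↔ (p : ℕ) < K - KM := by
  set π := magnitudeOrder F
  have hmono : ∀ p q, p ≤ q → channelMagnitude F (π q) ≤ channelMagnitude F (π p) := by
    intro p q hpq
    exact neg_le_neg_iff.1 (Tuple.monotone_sort (fun k => -channelMagnitude F k) hpq)
  have hdown : ∀ p q, p ≤ q → π q ∈ honestUsers K KM → π p ∈ honestUsers K KM := by
    intro p q hpq hq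
    by_contra hp
    exact (h _ hq _ hp).not_ge (hmono p q hpq)
  have hcard : (Finset.univ.filter fun p => π p ∈ honestUsers K KM).card = K - KM := by
    rw [← card_honestUsers hK]
    refine Finset.card_bij (fun p _ => π p) (fun p hp => (Finset.mem_filter.1 hp).2)
      (fun p _ q _ hpq => π.injective hpq) fun k hk => ⟨π.symm k, ?_, π.apply_symm_apply k⟩
    simpa using hk
  constructor
  · intro hp
    have := Finset.card_le_card (show Finset.Iic p ⊆
      Finset.univ.filter fun p => π p ∈ honestUsers K KM from fun q hq =>
        Finset.mem_filter.2 ⟨Finset.mem_univ _, hdown q p (Finset.mem_Iic.1 hq) hp⟩)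
    rw [hcard, Fin.card_Iic] at this
    omega
  · intro hp
    by_contra hn
    have := Finset.card_le_card (show (Finset.univ.filter fun p => π p ∈ honestUsers K KM) ⊆
      Finset.Iio p from fun q hq => Finset.mem_Iio.2 (lt_of_not_ge fun hpq =>
        hn (hdown p q hpq (Finset.mem_filter.1 hq).2)))
    rw [hcard, Fin.card_Iio] at this
    omega

lemma blockUsers_injective {T KB : ℕ} (π : Equiv.Perm (Fin (T * KB))) (t : Fin T) :
    Function.Injective (blockUsers π t) := fun _ _ hij =>
  (Prod.ext_iff.1 (finProdFinEquiv.injective (π.injective hij))).2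

/-- A bound on the Gram deviation under which underreporting by `δ` is always detected by the
magnitude order. -/
lemma exists_gramDev_lt_magnitude_lt (K KM : ℕ) {β δ : ℝ} (hβ : 0 < β) (hδ0 : 0 < δ)
    (hδ1 : δ < 1) : ∃ η > 0, ∀ M ≠ 0, ∀ G : Matrix (Fin K) (Fin M) ℂ,
      gramDev β (normGram G) < η → ∀ k ∈ honestUsers K KM, ∀ l ∉ honestUsers K KM,
        channelMagnitude (reportedCSI KM δ G) l < channelMagnitude (reportedCSI KM δ G) k := by
  -- with `r = β (1 - δ) / 2`, one has `δ (β + r) < β - r`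
  have hr : 0 < β * (1 - δ) / 2 := by have := sub_pos.2 hδ1; positivity
  refine ⟨(β * (1 - δ) / 2) ^ 2, by positivity, fun M hM G hG k hk l hl => ?_⟩
  have habs : ∀ i, |(normGram G i i).re - β| < β * (1 - δ) / 2 := fun i =>
    abs_lt_of_sq_lt_sq ((sub_re_sq_le_gramDev β (normGram G) i).trans_lt hG) hr.le
  have hk' : ¬ (k : ℕ) < KM := by simpa [honestUsers] using hk
  have hl' : (l : ℕ) < KM := by simpa [honestUsers] using hl
  rw [channelMagnitude_reportedCSI hδ0, channelMagnitude_reportedCSI hδ0, if_neg hk', if_pos hl',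
    channelMagnitude_eq hM, channelMagnitude_eq hM, mul_left_comm, one_mul]
  have hM0 : (0 : ℝ) < M := by positivity
  refine mul_lt_mul_of_pos_left ?_ hM0
  have h1 := (abs_lt.1 (habs k)).1
  have h2 := (abs_lt.1 (habs l)).2
  have h3 : δ * (normGram G l l).re ≤ δ * (β + β * (1 - δ) / 2) := by gcongr; linarith
  nlinarith [mul_pos hβ (mul_pos (sub_pos.2 hδ1) (sub_pos.2 hδ1))]

lemma blockUsers_mem_honestUsers_iff {T KB KM M : ℕ} (hK : KM ≤ T * KB)
    {F : Matrix (Fin (T * KB)) (Fin M) ℂ}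
    (h : ∀ k ∈ honestUsers (T * KB) KM, ∀ l ∉ honestUsers (T * KB) KM,
      channelMagnitude F l < channelMagnitude F k) (t : Fin T) (j : Fin KB) :
    blockUsers (magnitudeOrder F) t j ∈ honestUsers (T * KB) KM ↔
      (j : ℕ) + KB * t < T * KB - KM :=
  magnitudeOrder_mem_honestUsers_iff hK h _

lemma blockLoad_of_honest {K n KM : ℕ} {δ : ℝ} {S : Fin n → Fin K}
    (h : ∀ j, S j ∈ honestUsers K KM) : blockLoad KM δ S = n := by
  have : ∀ j, ¬ ((S j : Fin K) : ℕ) < KM := fun j => by simpa [honestUsers] using h j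
  simp [blockLoad, this]

lemma blockLoad_last {T KB KM M : ℕ} [NeZero T] (hKM : KM ≤ KB) {δ : ℝ}
    {F : Matrix (Fin (T * KB)) (Fin M) ℂ}
    (h : ∀ k ∈ honestUsers (T * KB) KM, ∀ l ∉ honestUsers (T * KB) KM,
      channelMagnitude F l < channelMagnitude F k) :
    blockLoad KM δ (blockUsers (magnitudeOrder F) (⊤ : Fin T)) = KM / δ + (KB - KM) := by
  have hT : 0 < T := Nat.pos_of_ne_zero (NeZero.ne T)
  have hTK : KB * (T - 1) + KB = T * KB := by
    obtain ⟨s, rfl⟩ : ∃ s, T = s + 1 := ⟨T - 1, by omega⟩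
    rw [Nat.add_sub_cancel]; ring
  have htop : ((⊤ : Fin T) : ℕ) = T - 1 := by simp [Fin.val_top]
  have hiff : ∀ j : Fin KB, ((blockUsers (magnitudeOrder F) (⊤ : Fin T) j : Fin (T * KB)) : ℕ) < KM ↔
      ¬ (j : ℕ) < KB - KM := by
    intro j
    have h1 := blockUsers_mem_honestUsers_iff (by omega) h (⊤ : Fin T) j
    rw [htop] at h1
    have h2 : blockUsers (magnitudeOrder F) (⊤ : Fin T) j ∈ honestUsers (T * KB) KM ↔
      ¬ ((blockUsers (magnitudeOrder F) (⊤ : Fin T) j : Fin (T * KB)) : ℕ) < KM := by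
      simp [honestUsers]
    rw [← not_iff_not, ← h2, h1]
    omega
  have h3 : ∀ j : Fin KB, (if ((blockUsers (magnitudeOrder F) (⊤ : Fin T) j : Fin (T * KB)) : ℕ) < KM
      then δ⁻¹ else 1) = δ⁻¹ + (if (j : ℕ) < KB - KM then 1 - δ⁻¹ else 0) := by
    intro j
    by_cases hj : (j : ℕ) < KB - KM
    · rw [if_neg (fun hc => (hiff j).1 hc hj), if_pos hj]; ring
    · rw [if_pos ((hiff j).2 hj), if_neg hj, add_zero]
  rw [blockLoad, Finset.sum_congr rfl fun j _ => h3 j, Finset.sum_add_distrib, ← Finset.sum_filter,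
    Finset.sum_const, Finset.sum_const, Fin.card_filter_val_lt, min_eq_right (Nat.sub_le _ _),
    Finset.card_univ, Fintype.card_fin, nsmul_eq_mul, nsmul_eq_mul, Nat.cast_sub hKM]
  ring

/-! ### Measurability -/

lemma measurableSet_sort_eq {n : ℕ} (π : Equiv.Perm (Fin n)) :
    MeasurableSet {x : Fin n → ℝ | Tuple.sort x = π} := by
  have : {x : Fin n → ℝ | Tuple.sort x = π} = (⋂ i, ⋂ j, {x | i ≤ j → x (π i) ≤ x (π j)}) ∩
      ⋂ i, ⋂ j, {x | i < j → x (π i) = x (π j) → π i < π j} := by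
    ext x
    simp only [Set.mem_inter_iff, Set.mem_iInter, Set.mem_ofPred_eq]
    rw [eq_comm, Tuple.eq_sort_iff]
    exact and_congr_left fun _ => ⟨fun h i j hij => h hij, fun h i j hij => h i j hij⟩
  rw [this]
  have hle : ∀ i j, MeasurableSet {x : Fin n → ℝ | x (π i) ≤ x (π j)} := fun i j =>
    measurableSet_le (measurable_pi_apply _) (measurable_pi_apply _)
  have heq : ∀ i j, MeasurableSet {x : Fin n → ℝ | x (π i) = x (π j)} := fun i j =>
    measurableSet_eq_fun (measurable_pi_apply _) (measurable_pi_apply _)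
  refine (MeasurableSet.iInter fun i => .iInter fun j => ?_).inter
    (.iInter fun i => .iInter fun j => ?_)
  · exact (MeasurableSet.const _).imp (hle i j)
  · exact (MeasurableSet.const _).imp ((heq i j).imp (MeasurableSet.const _))

lemma measurable_of_finite_choice {α ι : Type*} [MeasurableSpace α] [Fintype ι] {o : α → ι}
    (ho : ∀ i, MeasurableSet {a | o a = i}) {f : ι → α → ℝ} (hf : ∀ i, Measurable (f i)) :
    Measurable fun a => f (o a) a := by
  classical
  have : (fun a => f (o a) a) = fun a => ∑ i, {a | o a = i}.indicator (f i) a := by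
    ext a
    rw [Finset.sum_eq_single (o a)]
    · rw [Set.indicator_of_mem (by rfl)]
    · intro i _ hi
      exact Set.indicator_of_notMem (fun h => hi h.symm) _
    · simp
  rw [this]
  exact Finset.measurable_sum _ fun i _ => (hf i).indicator (ho i)

lemma measurable_zfPrecoder_apply {α : Type*} [TopologicalSpace α] [MeasurableSpace α]
    [OpensMeasurableSpace α] {n M : ℕ} {F : α → Matrix (Fin n) (Fin M) ℂ} (hF : Continuous F)
    (i : Fin M) (j : Fin n) : Measurable fun a => zfPrecoder (F a) i j := by
  have hA : Continuous fun a => F a * (F a).conjTranspose := by fun_prop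
  have hinv : ∀ k, Measurable fun a => (F a * (F a).conjTranspose)⁻¹ k j := by
    intro k
    simp only [Matrix.inv_def, Ring.inverse_eq_inv', Matrix.smul_apply, smul_eq_mul]
    exact hA.matrix_det.measurable.inv.mul
      (hA.matrix_adjugate.matrix_elem k j).measurable
  simp only [zfPrecoder, Matrix.mul_apply]
  exact Finset.measurable_sum _ fun k _ =>
    (hF.matrix_conjTranspose.matrix_elem i k).measurable.mul (hinv k)

lemma measurable_userRate {α : Type*} [TopologicalSpace α] [MeasurableSpace α]
    [OpensMeasurableSpace α] {n M : ℕ} {P σ : ℝ} {F G : α → Matrix (Fin n) (Fin M) ℂ}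
    (hF : Continuous F) (hG : Continuous G) (k : Fin n) :
    Measurable fun a => userRate P σ (F a) (G a) k := by
  have hb : ∀ j, Measurable fun a => beamScale (F a) j := by
    intro j
    have := fun i => measurable_zfPrecoder_apply hF i j
    unfold beamScale
    fun_prop
  have hp : ∀ j, Measurable fun a => maxMinPower P (F a) j := by
    intro j
    unfold maxMinPower
    fun_prop
  have he : ∀ j, Measurable fun a => effectiveChannel P (F a) (G a) k j := by
    intro j
    have : (fun a => effectiveChannel P (F a) (G a) k j) = fun a =>
        (∑ i, G a k i * zfPrecoder (F a) i j) * (beamScale (F a) j : ℂ) *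
          (Real.sqrt (maxMinPower P (F a) j) : ℂ) := by
      ext a
      rw [effectiveChannel, Matrix.mul_diagonal, Matrix.mul_diagonal, Matrix.mul_apply]
    rw [this]
    refine ((Finset.measurable_sum _ fun i _ => ?_).mul ?_).mul ?_
    · exact (hG.matrix_elem k i).measurable.mul (measurable_zfPrecoder_apply hF i j)
    · exact Complex.measurable_ofReal.comp (hb j)
    · exact Complex.measurable_ofReal.comp (hp j).sqrt
  unfold userRate receivedSINR Real.logb
  fun_prop

lemma continuous_reportedCSI {K M : ℕ} (KM : ℕ) (δ : ℝ) :
    Continuous fun G : Fin K → Fin M → ℂ => reportedCSI KM δ (Matrix.of G) := by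
  have : Continuous fun G : Fin K → Fin M → ℂ => Matrix.of G := continuous_id
  unfold reportedCSI
  fun_prop

lemma measurable_groupRate_reported {K n M KM : ℕ} {P σ δ : ℝ} (H : Finset (Fin K))
    (S : Fin n → Fin K) : Measurable fun G : Fin K → Fin M → ℂ =>
      groupRate P σ (reportedCSI KM δ (Matrix.of G)) (Matrix.of G) H S := by
  have h1 : Continuous fun G : Fin K → Fin M → ℂ => Matrix.of G := continuous_id
  have h2 := continuous_reportedCSI (K := K) (M := M) KM δ
  unfold groupRate
  refine (Finset.measurable_sum _ fun j _ => ?_).div_const _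
  exact measurable_userRate (h2.matrix_submatrix S id) (h1.matrix_submatrix S id) j

lemma measurableSet_magnitudeOrder_eq {K M KM : ℕ} {δ : ℝ} (π : Equiv.Perm (Fin K)) :
    MeasurableSet {G : Fin K → Fin M → ℂ |
      magnitudeOrder (reportedCSI KM δ (Matrix.of G)) = π} := by
  have h : Measurable fun G : Fin K → Fin M → ℂ => fun k =>
      -channelMagnitude (reportedCSI KM δ (Matrix.of G)) k := by
    have h2 := continuous_reportedCSI (K := K) (M := M) KM δ
    refine measurable_pi_lambda _ fun k => Continuous.measurable ?_
    have := fun i => h2.matrix_elem k i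
    unfold channelMagnitude
    fun_prop
  exact h (measurableSet_sort_eq π)

/-! ### Moments of the channel law -/

lemma measurable_complex_mk : Measurable fun p : ℝ × ℝ => (⟨p.1, p.2⟩ : ℂ) :=
  Complex.measurableEquivRealProd.symm.measurable

instance (β : ℝ) : IsProbabilityMeasure (complexGaussian β) :=
  Measure.isProbabilityMeasure_map measurable_complex_mk.aemeasurable

lemma memLp_id_complexGaussian (β : ℝ) (p : NNReal) :
    MemLp (fun z : ℂ => z) p (complexGaussian β) := by
  rw [complexGaussian, memLp_map_measure_iff (by fun_prop) measurable_complex_mk.aemeasurable]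
  have h1 : (fun z : ℂ => z) ∘ (fun p : ℝ × ℝ => (⟨p.1, p.2⟩ : ℂ)) =
      fun p : ℝ × ℝ => (p.1 : ℂ) + Complex.I * (p.2 : ℂ) := by
    ext q
    simp [Complex.ext_iff]
  rw [h1]
  have h2 : MemLp (fun x : ℝ => x) p (gaussianReal 0 (β / 2).toNNReal) := memLp_id_gaussianReal p
  have h3 : MemLp (fun q : ℝ × ℝ => (q.1 : ℂ)) p
      ((gaussianReal 0 (β / 2).toNNReal).prod (gaussianReal 0 (β / 2).toNNReal)) :=
    (h2.comp_fst _).ofReal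
  have h4 : MemLp (fun q : ℝ × ℝ => (q.2 : ℂ)) p
      ((gaussianReal 0 (β / 2).toNNReal).prod (gaussianReal 0 (β / 2).toNNReal)) :=
    (h2.comp_snd _).ofReal
  exact h3.add (h4.const_mul Complex.I)

lemma integral_complexGaussian (β : ℝ) : ∫ z, z ∂complexGaussian β = 0 := by
  have h2 := (memLp_id_gaussianReal (μ := 0) (v := (β / 2).toNNReal) 1).integrable le_rfl
  rw [complexGaussian, integral_map measurable_complex_mk.aemeasurable (by fun_prop)]
  have h1 : ∀ p : ℝ × ℝ, (⟨p.1, p.2⟩ : ℂ) = (p.1 : ℂ) + Complex.I * (p.2 : ℂ) := fun q => by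
    simp [Complex.ext_iff]
  simp only [h1]
  rw [integral_add (h2.comp_fst _).ofReal ((h2.comp_snd _).ofReal.const_mul _),
    integral_const_mul, integral_fun_fst (fun x : ℝ => (x : ℂ)),
    integral_fun_snd (fun x : ℝ => (x : ℂ)),
    integral_complex_ofReal (f := fun x : ℝ => x), integral_id_gaussianReal]
  simp

lemma integral_norm_sq_complexGaussian {β : ℝ} (hβ : 0 < β) :
    ∫ z, ‖z‖ ^ 2 ∂complexGaussian β = β := by
  have h2 : Integrable (fun x : ℝ => x ^ 2) (gaussianReal 0 (β / 2).toNNReal) :=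
    (memLp_id_gaussianReal 2).integrable_sq
  rw [complexGaussian, integral_map measurable_complex_mk.aemeasurable (by fun_prop)]
  have h1 : ∀ p : ℝ × ℝ, ‖(⟨p.1, p.2⟩ : ℂ)‖ ^ 2 = p.1 ^ 2 + p.2 ^ 2 := fun q => by
    rw [Complex.sq_norm, Complex.normSq_mk]; ring
  have h3 : ∫ x, x ^ 2 ∂gaussianReal 0 (β / 2).toNNReal = β / 2 := by
    have := variance_of_integral_eq_zero (X := id) (μ := gaussianReal 0 (β / 2).toNNReal)
      (by fun_prop) (by simp [integral_id_gaussianReal])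
    rw [variance_id_gaussianReal, Real.coe_toNNReal _ (by positivity)] at this
    exact this.symm
  simp only [h1]
  rw [integral_add (h2.comp_fst _) (h2.comp_snd _), integral_fun_fst (fun x : ℝ => x ^ 2),
    integral_fun_snd (fun x : ℝ => x ^ 2), h3]
  simp

lemma integral_comp_eval {ι Ω E : Type*} [Fintype ι] [MeasurableSpace Ω] [NormedAddCommGroup E]
    [NormedSpace ℝ E] {μ : Measure Ω} [IsProbabilityMeasure μ] {f : Ω → E}
    (hf : AEStronglyMeasurable f μ) (i : ι) :
    ∫ x : ι → Ω, f (x i) ∂(Measure.pi fun _ => μ) = ∫ a, f a ∂μ := by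
  have hp := measurePreserving_eval (fun _ : ι => μ) i
  rw [← hp.map_eq] at hf
  rw [← integral_map hp.measurable.aemeasurable hf, hp.map_eq]

/-- Law of one column of the channel matrix: the channels of all users to one antenna. -/
def columnLaw (K : ℕ) (β : ℝ) : Measure (Fin K → ℂ) := Measure.pi fun _ => complexGaussian β

instance (K : ℕ) (β : ℝ) : IsProbabilityMeasure (columnLaw K β) := by
  unfold columnLaw; infer_instance

instance (K M : ℕ) (β : ℝ) : IsProbabilityMeasure (channelLaw K M β) := by
  unfold channelLaw; infer_instance

/-- The columns of the channel matrix are independent with law `columnLaw`. -/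
lemma map_transpose_channelLaw (K M : ℕ) (β : ℝ) :
    (channelLaw K M β).map (fun G i k => G k i) = Measure.pi fun _ => columnLaw K β := by
  have hm : Measurable fun (G : Fin K → Fin M → ℂ) (i : Fin M) (k : Fin K) => G k i := by fun_prop
  symm
  refine Measure.pi_eq_generateFrom
    (C := fun _ => Set.pi Set.univ '' Set.pi Set.univ fun _ => {s : Set ℂ | MeasurableSet s})
    (fun _ => generateFrom_pi) (fun _ => isPiSystem_pi) (fun _ => ?_) ?_
  · exact Measure.FiniteSpanningSetsIn.pi (μ := fun _ : Fin K => complexGaussian β)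
      fun _ => Measure.toFiniteSpanningSetsIn _
  · intro s hs
    choose t ht hts using hs
    have h1 : (fun (G : Fin K → Fin M → ℂ) (i : Fin M) (k : Fin K) => G k i) ⁻¹'
        Set.pi Set.univ s = Set.pi Set.univ fun k => Set.pi Set.univ fun i => t i k := by
      ext G
      simp only [← hts, Set.mem_preimage, Set.mem_univ_pi]
      exact forall_comm
    have hs' : ∀ i, MeasurableSet (s i) := fun i => by
      rw [← hts i]
      exact MeasurableSet.univ_pi fun k => ht i k (Set.mem_univ _)
    rw [Measure.map_apply hm (MeasurableSet.univ_pi hs'), h1, channelLaw]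
    simp only [Measure.pi_pi, columnLaw, ← hts]
    exact Finset.prod_comm

/-- Second-moment law of large numbers for i.i.d. square-integrable variables. -/
lemma integral_sample_mean_sub_sq {Ω : Type*} [MeasurableSpace Ω] {μ : Measure Ω}
    [IsProbabilityMeasure μ] {h : Ω → ℝ} (hh : MemLp h 2 μ) {M : ℕ} (hM : M ≠ 0) :
    Integrable (fun x : Fin M → Ω => ((M : ℝ)⁻¹ * ∑ i, h (x i) - ∫ a, h a ∂μ) ^ 2)
        (Measure.pi fun _ => μ) ∧
      ∫ x : Fin M → Ω, ((M : ℝ)⁻¹ * ∑ i, h (x i) - ∫ a, h a ∂μ) ^ 2 ∂(Measure.pi fun _ => μ) =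
        Var[h; μ] / M := by
  have hM0 : (M : ℝ) ≠ 0 := Nat.cast_ne_zero.2 hM
  have hi : ∀ i : Fin M, MemLp (fun x : Fin M → Ω => h (x i)) 2 (Measure.pi fun _ => μ) :=
    fun i => hh.comp_measurePreserving (measurePreserving_eval (fun _ => μ) i)
  have hmem : MemLp (fun x : Fin M → Ω => (M : ℝ)⁻¹ * ∑ i, h (x i)) 2 (Measure.pi fun _ => μ) :=
    (memLp_finsetSum _ fun i _ => hi i).const_mul _
  have hmean : ∫ x : Fin M → Ω, (M : ℝ)⁻¹ * ∑ i, h (x i) ∂(Measure.pi fun _ => μ) =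
      ∫ a, h a ∂μ := by
    rw [integral_const_mul, integral_finsetSum _ fun i _ => (hi i).integrable one_le_two]
    have := integral_comp_eval (ι := Fin M) hh.aestronglyMeasurable
    simp only [this, Finset.sum_const, Finset.card_univ, Fintype.card_fin, nsmul_eq_mul]
    field_simp
  refine ⟨(hmem.sub (memLp_const _)).integrable_sq, ?_⟩
  have h1 := variance_eq_integral hmem.aestronglyMeasurable.aemeasurable
  rw [hmean] at h1
  rw [← h1, variance_const_mul]
  have h2 := variance_sum_pi (μ := fun _ : Fin M => μ) (X := fun _ => h) fun _ => hh
  have h3 : (∑ i : Fin M, fun ω : Fin M → Ω => h (ω i)) = fun ω => ∑ i, h (ω i) := by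
    ext ω; simp
  rw [h3] at h2
  rw [h2]
  simp only [Finset.sum_const, Finset.card_univ, Fintype.card_fin, nsmul_eq_mul]
  field_simp

lemma memLp_mul_conj_columnLaw {K : ℕ} (β : ℝ) (k l : Fin K) :
    MemLp (fun c : Fin K → ℂ => c k * starRingEnd ℂ (c l)) 2 (columnLaw K β) := by
  have h : ∀ k, MemLp (fun c : Fin K → ℂ => c k) 4 (columnLaw K β) := fun k =>
    (memLp_id_complexGaussian β 4).comp_measurePreserving
      (measurePreserving_eval (fun _ => complexGaussian β) k)
  have : ENNReal.HolderTriple 4 4 2 := ⟨by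
    rw [← two_mul, show (4 : ENNReal) = 2 * 2 by norm_num,
      ENNReal.mul_inv (Or.inl (by norm_num)) (Or.inl (by norm_num)), ← mul_assoc,
      ENNReal.mul_inv_cancel (by norm_num) (by norm_num), one_mul]⟩
  exact (h l).star.mul (h k)

lemma integral_mul_conj_columnLaw {K : ℕ} {β : ℝ} (hβ : 0 < β) (k l : Fin K) :
    ∫ c, c k * starRingEnd ℂ (c l) ∂columnLaw K β = (diagonal fun _ => (β : ℂ)) k l := by
  have hev : ∀ (k : Fin K) (f : ℂ → ℂ), Continuous f →
      ∫ c, f (c k) ∂columnLaw K β = ∫ z, f z ∂complexGaussian β := fun k f hf =>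
    integral_comp_eval hf.aestronglyMeasurable k
  rcases eq_or_ne k l with rfl | hkl
  · have h1 : ∀ z : ℂ, z * starRingEnd ℂ z = ((‖z‖ ^ 2 : ℝ) : ℂ) := fun z => by
      rw [Complex.mul_conj', Complex.ofReal_pow]
    rw [diagonal_apply_eq, hev k (fun z => z * starRingEnd ℂ z) (by fun_prop)]
    simp only [h1]
    rw [integral_complex_ofReal, integral_norm_sq_complexGaussian hβ]
  · have hind : iIndepFun (fun (k : Fin K) (c : Fin K → ℂ) => c k) (columnLaw K β) :=
      iIndepFun_pi (X := fun _ z => z) fun _ => aemeasurable_id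
    have h2 := (hind.indepFun hkl).comp measurable_id
      (Complex.continuous_conj.measurable)
    rw [diagonal_apply_ne _ hkl]
    have h3 := h2.integral_fun_mul_eq_mul_integral
      (measurable_pi_apply k).aestronglyMeasurable
      (Complex.continuous_conj.measurable.comp (measurable_pi_apply l)).aestronglyMeasurable
    simp only [Function.comp, id] at h3
    rw [h3, hev k (fun z => z) continuous_id, integral_complexGaussian, zero_mul]

lemma normGram_apply {K M : ℕ} (G : Matrix (Fin K) (Fin M) ℂ) (k l : Fin K) :
    normGram G k l = ((M : ℝ)⁻¹ : ℝ) * ∑ i, G k i * starRingEnd ℂ (G l i) := by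
  simp [normGram, Matrix.mul_apply]

/-- The Gram matrix deviates from `β I` by `O(1 / M)` in mean square. -/
lemma exists_integral_gramDev_eq (K : ℕ) {β : ℝ} (hβ : 0 < β) : ∃ C, ∀ M ≠ 0,
    Integrable (fun G => gramDev β (normGram (Matrix.of G))) (channelLaw K M β) ∧
      ∫ G, gramDev β (normGram (Matrix.of G)) ∂channelLaw K M β = C / M := by
  set h : Fin K → Fin K → (Fin K → ℂ) → ℂ := fun k l c => c k * starRingEnd ℂ (c l)
  refine ⟨∑ k, ∑ l, (Var[fun c => (h k l c).re; columnLaw K β] +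
    Var[fun c => (h k l c).im; columnLaw K β]), fun M hM => ?_⟩
  have hre : ∀ k l, MemLp (fun c => (h k l c).re) 2 (columnLaw K β) := fun k l =>
    (memLp_mul_conj_columnLaw β k l).re
  have him : ∀ k l, MemLp (fun c => (h k l c).im) 2 (columnLaw K β) := fun k l =>
    (memLp_mul_conj_columnLaw β k l).im
  have hmre : ∀ k l, ∫ c, (h k l c).re ∂columnLaw K β =
      ((diagonal fun _ => (β : ℂ)) k l : ℂ).re := fun k l => by
    rw [← integral_mul_conj_columnLaw hβ]
    exact integral_re ((memLp_mul_conj_columnLaw β k l).integrable one_le_two)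
  have hmim : ∀ k l, ∫ c, (h k l c).im ∂columnLaw K β =
      ((diagonal fun _ => (β : ℂ)) k l : ℂ).im := fun k l => by
    rw [← integral_mul_conj_columnLaw hβ]
    exact integral_im ((memLp_mul_conj_columnLaw β k l).integrable one_le_two)
  have hm : Measurable fun (G : Fin K → Fin M → ℂ) (i : Fin M) (k : Fin K) => G k i := by fun_prop
  set g : (Fin M → Fin K → ℂ) → ℝ := fun x => ∑ k, ∑ l,
    (((M : ℝ)⁻¹ * ∑ i, (h k l (x i)).re - ∫ c, (h k l c).re ∂columnLaw K β) ^ 2 +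
      ((M : ℝ)⁻¹ * ∑ i, (h k l (x i)).im - ∫ c, (h k l c).im ∂columnLaw K β) ^ 2) with hg
  have hgc : Continuous g := by
    simp only [hg, h]
    fun_prop
  have hdev : (fun G : Fin K → Fin M → ℂ => gramDev β (normGram (Matrix.of G))) =
      fun G => g (fun i k => G k i) := by
    ext G
    simp only [gramDev, hg, hmre, hmim]
    refine Finset.sum_congr rfl fun k _ => Finset.sum_congr rfl fun l _ => ?_
    rw [normGram_apply, Complex.sq_norm, Complex.normSq_apply, Complex.sub_re, Complex.sub_im,
      Complex.re_ofReal_mul, Complex.im_ofReal_mul, Complex.re_sum, Complex.im_sum]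
    simp only [h, Matrix.of_apply, sq]
  have hi1 := fun k l => integral_sample_mean_sub_sq (hre k l) hM
  have hi2 := fun k l => integral_sample_mean_sub_sq (him k l) hM
  have hsum : ∀ k l, Integrable (fun x : Fin M → Fin K → ℂ =>
      ((M : ℝ)⁻¹ * ∑ i, (h k l (x i)).re - ∫ c, (h k l c).re ∂columnLaw K β) ^ 2 +
        ((M : ℝ)⁻¹ * ∑ i, (h k l (x i)).im - ∫ c, (h k l c).im ∂columnLaw K β) ^ 2)
      (Measure.pi fun _ => columnLaw K β) := fun k l => (hi1 k l).1.add (hi2 k l).1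
  have hgi : Integrable g (Measure.pi fun _ : Fin M => columnLaw K β) :=
    integrable_finsetSum _ fun k _ => integrable_finsetSum _ fun l _ => hsum k l
  rw [hdev]
  constructor
  · rw [← map_transpose_channelLaw] at hgi
    exact hgi.comp_measurable hm
  · rw [← integral_map (f := g) hm.aemeasurable hgc.aestronglyMeasurable,
      map_transpose_channelLaw]
    simp only [hg]
    rw [integral_finsetSum _ fun k _ => integrable_finsetSum _ fun l _ => hsum k l, Finset.sum_div]
    refine Finset.sum_congr rfl fun k _ => ?_
    rw [integral_finsetSum _ fun l _ => hsum k l, Finset.sum_div]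
    refine Finset.sum_congr rfl fun l _ => ?_
    rw [integral_add (hi1 k l).1 (hi2 k l).1, (hi1 k l).2, (hi2 k l).2, add_div]

/-! ### Limits of the expected rates -/

lemma tendsto_logb_natCast_atTop : Tendsto (fun M : ℕ => Real.logb 2 (M : ℝ)) atTop atTop :=
  (Real.tendsto_logb_atTop one_lt_two).comp tendsto_natCast_atTop_atTop

lemma tendsto_logb_add_one_div : Tendsto (fun M : ℕ => (Real.logb 2 (M : ℝ) + 1) / M) atTop (𝓝 0) := by
  have h1 : Tendsto (fun x : ℝ => Real.log x / x) atTop (𝓝 0) :=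
    Real.isLittleO_log_id_atTop.tendsto_div_nhds_zero
  have h2 := (h1.comp tendsto_natCast_atTop_atTop).div_const (Real.log 2)
  have h3 := h2.add (tendsto_inv_atTop_nhds_zero_nat (𝕜 := ℝ))
  rw [zero_div, add_zero] at h3
  refine h3.congr fun M => ?_
  simp only [Function.comp, Real.logb]
  ring

/-- The expected honest rate of a block with load `s` is `log₂ M + log₂ (P β / (σ² s)) + o(1)`. The
order in which users are served may depend on the channels, and the load only has to be `s` for
channels whose Gram matrix is close to its mean. -/
lemma tendsto_integral_groupRate {T KB KM : ℕ} {P σ δ β η₀ s : ℝ} (hKB : 0 < KB) (hP : 0 < P)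
    (hσ : 0 < σ) (hδ : 0 < δ) (hβ : 0 < β) (hη₀ : 0 < η₀) (t : Fin T)
    (o : ∀ M, (Fin (T * KB) → Fin M → ℂ) → Equiv.Perm (Fin (T * KB)))
    (ho : ∀ M π, MeasurableSet {G | o M G = π})
    (hgood : ∀ M ≠ 0, ∀ G : Fin (T * KB) → Fin M → ℂ, gramDev β (normGram (Matrix.of G)) < η₀ →
      (∃ j, blockUsers (o M G) t j ∈ honestUsers (T * KB) KM) ∧
        blockLoad KM δ (blockUsers (o M G) t) = s) :
    Tendsto (fun M => (∫ G, groupRate P σ (reportedCSI KM δ (Matrix.of G)) (Matrix.of G)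
      (honestUsers (T * KB) KM) (blockUsers (o M G) t) ∂channelLaw (T * KB) M β) - Real.logb 2 M)
      atTop (𝓝 (Real.logb 2 (P * β / (σ ^ 2 * s)))) := by
  obtain ⟨D, hD⟩ := exists_integral_gramDev_eq (T * KB) hβ
  refine Metric.tendsto_nhds.2 fun ε hε => ?_
  obtain ⟨C, hC⟩ := exists_abs_groupRate_sub_le (K := T * KB) (KM := KM) (s := s) hKB hP hσ hδ hβ
    hη₀ (half_pos hε)
  have hsmall : ∀ᶠ M : ℕ in atTop, C * D * ((Real.logb 2 (M : ℝ) + 1) / M) < ε / 2 := by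
    have := tendsto_logb_add_one_div.const_mul (C * D)
    rw [mul_zero] at this
    exact this.eventually_lt_const (half_pos hε)
  filter_upwards [hC, hsmall, eventually_ne_atTop 0] with M hM hMs hM0
  obtain ⟨hint, hval⟩ := hD M hM0
  set L := Real.logb 2 (P * β / (σ ^ 2 * s))
  set f : (Fin (T * KB) → Fin M → ℂ) → ℝ := fun G =>
    groupRate P σ (reportedCSI KM δ (Matrix.of G)) (Matrix.of G) (honestUsers (T * KB) KM)
      (blockUsers (o M G) t) with hf
  have hfm : Measurable f := measurable_of_finite_choice (ho M)
    (f := fun π G => groupRate P σ (reportedCSI KM δ (Matrix.of G)) (Matrix.of G)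
      (honestUsers (T * KB) KM) (blockUsers π t)) fun π => measurable_groupRate_reported _ _
  have hbound : ∀ G, ‖f G - Real.logb 2 M - L‖ ≤
      ε / 2 + C * (Real.logb 2 M + 1) * gramDev β (normGram (Matrix.of G)) := fun G =>
    hM (Matrix.of G) _ (blockUsers_injective _ t) (hgood M hM0 G)
  have hbi : Integrable (fun G => ε / 2 + C * (Real.logb 2 M + 1) *
      gramDev β (normGram (Matrix.of G))) (channelLaw (T * KB) M β) :=
    (integrable_const _).add (hint.const_mul _)
  have hfi' : Integrable (fun G => f G - Real.logb 2 M - L) (channelLaw (T * KB) M β) :=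
    hbi.mono' ((hfm.sub_const _).sub_const _).aestronglyMeasurable (ae_of_all _ hbound)
  have hfi : Integrable f (channelLaw (T * KB) M β) := by
    have := hfi'.add (integrable_const (Real.logb 2 M + L))
    refine this.congr (ae_of_all _ fun G => ?_)
    simp only [Pi.add_apply]
    ring
  have hsub : (∫ G, f G ∂channelLaw (T * KB) M β) - Real.logb 2 M - L =
      ∫ G, (f G - Real.logb 2 M - L) ∂channelLaw (T * KB) M β := by
    simp only [sub_sub]
    rw [integral_sub hfi (integrable_const _)]
    simp
  rw [Real.dist_eq, hsub, ← Real.norm_eq_abs]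
  calc _ ≤ ∫ G, (ε / 2 + C * (Real.logb 2 M + 1) * gramDev β (normGram (Matrix.of G)))
        ∂channelLaw (T * KB) M β := norm_integral_le_of_norm_le hbi (ae_of_all _ hbound)
    _ = ε / 2 + C * D * ((Real.logb 2 (M : ℝ) + 1) / M) := by
      rw [integral_add (integrable_const _) (hint.const_mul _), integral_const_mul, hval]
      simp
      ring
    _ < ε := by linarith

lemma reportedCSI_zero {K M : ℕ} (δ : ℝ) (G : Matrix (Fin K) (Fin M) ℂ) :
    reportedCSI 0 δ G = G := by
  simp [reportedCSI]

lemma honestUsers_zero (K : ℕ) : honestUsers K 0 = Finset.univ := by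
  simp [honestUsers]

lemma tendsto_rateMisCM_of_ne_top {T KB KM : ℕ} [NeZero T] {β P σ δ : ℝ} (hKB : 0 < KB)
    (hKM : KM ≤ KB) (hβ : 0 < β) (hP : 0 < P) (hσ : 0 < σ) (hδ0 : 0 < δ) (hδ1 : δ < 1)
    {t : Fin T} (ht : t ≠ ⊤) :
    Tendsto (fun M : ℕ => rateMisCM T KB KM M β P σ δ t - Real.logb 2 M) atTop
      (𝓝 (Real.logb 2 (P * β / (σ ^ 2 * KB)))) := by
  obtain ⟨η, hη, hgood⟩ := exists_gramDev_lt_magnitude_lt (T * KB) KM hβ hδ0 hδ1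
  refine tendsto_integral_groupRate hKB hP hσ hδ0 hβ hη t
    (fun M G => magnitudeOrder (reportedCSI KM δ (Matrix.of G)))
    (fun M π => measurableSet_magnitudeOrder_eq π) fun M hM G hG => ?_
  have ht' : KB * ((t : ℕ) + 1) + KB ≤ T * KB := by
    have h1 : (t : ℕ) < T - 1 := by
      have := lt_top_iff_ne_top.2 ht
      rwa [Fin.lt_def, Fin.val_top] at this
    have h2 : (t : ℕ) + 2 ≤ T := by omega
    nlinarith [Nat.mul_le_mul_left KB h2]
  have hall : ∀ j, blockUsers (magnitudeOrder (reportedCSI KM δ (Matrix.of G))) t j ∈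
      honestUsers (T * KB) KM := fun j => by
    rw [blockUsers_mem_honestUsers_iff (by omega) (hgood M hM (Matrix.of G) hG)]
    have := j.2
    rw [mul_add] at ht'
    omega
  exact ⟨⟨⟨0, hKB⟩, hall _⟩, blockLoad_of_honest hall⟩

lemma tendsto_rateMisCM_top {T KB KM : ℕ} [NeZero T] {β P σ δ : ℝ} (hKM : KM < KB) (hβ : 0 < β)
    (hP : 0 < P) (hσ : 0 < σ) (hδ0 : 0 < δ) (hδ1 : δ < 1) :
    Tendsto (fun M : ℕ => rateMisCM T KB KM M β P σ δ ⊤ - Real.logb 2 M) atTop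
      (𝓝 (Real.logb 2 (P * β / (σ ^ 2 * (KM / δ + (KB - KM)))))) := by
  obtain ⟨η, hη, hgood⟩ := exists_gramDev_lt_magnitude_lt (T * KB) KM hβ hδ0 hδ1
  refine tendsto_integral_groupRate (by omega) hP hσ hδ0 hβ hη ⊤
    (fun M G => magnitudeOrder (reportedCSI KM δ (Matrix.of G)))
    (fun M π => measurableSet_magnitudeOrder_eq π) fun M hM G hG => ?_
  have h := hgood M hM (Matrix.of G) hG
  refine ⟨⟨⟨0, by omega⟩, ?_⟩, blockLoad_last hKM.le h⟩
  obtain ⟨s, hs⟩ : ∃ s, T = s + 1 := ⟨T - 1, by have := NeZero.ne T; omega⟩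
  have hTK : KB * (T - 1) + KB = T * KB := by
    rw [hs, Nat.add_sub_cancel]; ring
  rw [blockUsers_mem_honestUsers_iff (by omega) h, Fin.val_top]
  simp only [zero_add]
  omega

lemma tendsto_rateAccCM {T KB : ℕ} {β P σ : ℝ} (hKB : 0 < KB) (hβ : 0 < β) (hP : 0 < P)
    (hσ : 0 < σ) (t : Fin T) :
    Tendsto (fun M : ℕ => rateAccCM T KB M β P σ t - Real.logb 2 M) atTop
      (𝓝 (Real.logb 2 (P * β / (σ ^ 2 * KB)))) := by
  have hall : ∀ k : Fin (T * KB), k ∈ honestUsers (T * KB) 0 := fun k => by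
    rw [honestUsers_zero]; exact Finset.mem_univ k
  have := tendsto_integral_groupRate (KM := 0) (s := KB) hKB hP hσ one_pos hβ one_pos t
    (fun M G => magnitudeOrder (reportedCSI 0 1 (Matrix.of G)))
    (fun M π => measurableSet_magnitudeOrder_eq π) fun M hM G hG =>
      ⟨⟨⟨0, hKB⟩, hall _⟩, blockLoad_of_honest fun _ => hall _⟩
  simp only [reportedCSI_zero, honestUsers_zero] at this
  exact this

lemma tendsto_rateAccRandBlock {T KB : ℕ} {β P σ : ℝ} (hKB : 0 < KB) (hβ : 0 < β) (hP : 0 < P)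
    (hσ : 0 < σ) (t : Fin T) :
    Tendsto (fun M : ℕ => rateAccRandBlock T KB M β P σ t - Real.logb 2 M) atTop
      (𝓝 (Real.logb 2 (P * β / (σ ^ 2 * KB)))) := by
  have hall : ∀ k : Fin (T * KB), k ∈ honestUsers (T * KB) 0 := fun k => by
    rw [honestUsers_zero]; exact Finset.mem_univ k
  have h := fun π : Equiv.Perm (Fin (T * KB)) =>
    tendsto_integral_groupRate (KM := 0) (s := KB) hKB hP hσ one_pos hβ one_pos t
      (fun _ _ => π) (fun M π => MeasurableSet.const _) fun M hM G hG =>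
      ⟨⟨⟨0, hKB⟩, hall _⟩, blockLoad_of_honest fun _ => hall _⟩
  simp only [reportedCSI_zero, honestUsers_zero] at h
  have hfac : ((T * KB)! : ℝ) ≠ 0 := Nat.cast_ne_zero.2 (Nat.factorial_ne_zero _)
  have h2 := (tendsto_finsetSum Finset.univ fun π _ => h π).div_const ((T * KB)! : ℝ)
  have hcard : ∀ x : ℝ, (∑ _π : Equiv.Perm (Fin (T * KB)), x) / ((T * KB)! : ℝ) = x := fun x => by
    rw [Finset.sum_const, Finset.card_univ, Fintype.card_perm, Fintype.card_fin, nsmul_eq_mul,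
      mul_div_cancel_left₀ _ hfac]
  rw [hcard] at h2
  refine h2.congr fun M => ?_
  rw [Finset.sum_sub_distrib, sub_div, hcard, rateAccRandBlock]

/-! ### Inverse moments of gamma order statistics -/

lemma gammaPDFReal_mul_inv {a r x : ℝ} (ha : 1 < a) (hr : 0 < r) (hx : x ≠ 0) :
    gammaPDFReal a r x * x⁻¹ = r / (a - 1) * gammaPDFReal (a - 1) r x := by
  unfold gammaPDFReal
  split_ifs with h
  · have hx0 : 0 < x := lt_of_le_of_ne h hx.symm
    have hG : Real.Gamma a = (a - 1) * Real.Gamma (a - 1) := by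
      have := Real.Gamma_add_one (s := a - 1) (by linarith)
      rwa [sub_add_cancel] at this
    have hG0 : Real.Gamma (a - 1) ≠ 0 := (Real.Gamma_pos_of_pos (by linarith)).ne'
    have ha0 : a - 1 ≠ 0 := by linarith
    have hra : r ^ a = r ^ (a - 1) * r := by
      rw [← Real.rpow_add_one hr.ne', sub_add_cancel]
    have hxa : x ^ (a - 1) = x ^ (a - 1 - 1) * x := by
      rw [← Real.rpow_add_one hx, sub_add_cancel]
    rw [hG, hra, hxa]
    field_simp
  · simp

lemma integrable_gammaMeasure_iff {a r : ℝ} (ha : 0 < a) (hr : 0 < r) {f : ℝ → ℝ} :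
    Integrable f (gammaMeasure a r) ↔ Integrable fun x => gammaPDFReal a r x * f x := by
  have hm : Measurable (gammaPDF a r) := (measurable_gammaPDFReal a r).ennreal_ofReal
  rw [gammaMeasure, integrable_withDensity_iff_integrable_smul' hm
    (ae_of_all _ fun _ => ENNReal.ofReal_lt_top)]
  simp only [gammaPDF, ENNReal.toReal_ofReal (gammaPDFReal_nonneg ha hr _), smul_eq_mul]

lemma integral_gammaMeasure {a r : ℝ} (ha : 0 < a) (hr : 0 < r) (f : ℝ → ℝ) :
    ∫ x, f x ∂gammaMeasure a r = ∫ x, gammaPDFReal a r x * f x := by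
  have hm : Measurable (gammaPDF a r) := (measurable_gammaPDFReal a r).ennreal_ofReal
  rw [gammaMeasure, integral_withDensity_eq_integral_toReal_smul hm
    (ae_of_all _ fun _ => ENNReal.ofReal_lt_top)]
  simp only [gammaPDF, ENNReal.toReal_ofReal (gammaPDFReal_nonneg ha hr _), smul_eq_mul]

/-- Weighting a gamma law by `1 / x` lowers its shape by one. -/
lemma integral_gammaMeasure_mul_inv {a r : ℝ} (ha : 1 < a) (hr : 0 < r) {f : ℝ → ℝ}
    (hf : Integrable f (gammaMeasure (a - 1) r)) :
    Integrable (fun x => f x * x⁻¹) (gammaMeasure a r) ∧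
      ∫ x, f x * x⁻¹ ∂gammaMeasure a r = r / (a - 1) * ∫ x, f x ∂gammaMeasure (a - 1) r := by
  have ha' : 0 < a - 1 := by linarith
  have hae : (fun x => r / (a - 1) * (gammaPDFReal (a - 1) r x * f x)) =ᵐ[volume]
      fun x => gammaPDFReal a r x * (f x * x⁻¹) := by
    filter_upwards [Measure.ae_ne volume (0 : ℝ)] with x hx
    rw [← mul_assoc, ← gammaPDFReal_mul_inv ha hr hx]
    ring
  rw [integrable_gammaMeasure_iff ha' hr] at hf
  rw [integrable_gammaMeasure_iff (by linarith) hr, integral_gammaMeasure (by linarith) hr,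
    integral_gammaMeasure ha' hr, ← integral_const_mul]
  exact ⟨(hf.const_mul _).congr hae, (integral_congr_ae hae).symm⟩

lemma integral_gammaMeasure_inv_dev {β : ℝ} (hβ : 0 < β) {M : ℕ} (hM : 3 ≤ M) :
    Integrable (fun x => ((M : ℝ) * x⁻¹ - β⁻¹) ^ 2) (gammaMeasure M (1 / β)) ∧
    ∫ x, ((M : ℝ) * x⁻¹ - β⁻¹) ^ 2 ∂gammaMeasure M (1 / β) =
      β⁻¹ ^ 2 * ((M : ℝ) / (M - 1) * (M / (M - 2)) - 2 * (M / (M - 1)) + 1) := by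
  have hM' : (3 : ℝ) ≤ M := by exact_mod_cast hM
  have hr : 0 < 1 / β := by positivity
  have hp : ∀ a : ℝ, 0 < a → IsProbabilityMeasure (gammaMeasure a (1 / β)) := fun a ha =>
    isProbabilityMeasure_gammaMeasure ha hr
  have := hp M (by linarith)
  have := hp (M - 1) (by linarith)
  have := hp (M - 1 - 1) (by linarith)
  have h1 : ∀ a : ℝ, 1 < a → Integrable (fun x => x⁻¹) (gammaMeasure a (1 / β)) ∧
      ∫ x, x⁻¹ ∂gammaMeasure a (1 / β) = 1 / β / (a - 1) := fun a ha => by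
    have := hp (a - 1) (by linarith)
    have h := integral_gammaMeasure_mul_inv (f := fun _ => (1 : ℝ)) ha hr (integrable_const _)
    simpa only [one_mul, integral_const, probReal_univ, one_smul, mul_one] using h
  obtain ⟨hi1, hv1⟩ := h1 M (by linarith)
  obtain ⟨hi2, hv2⟩ := integral_gammaMeasure_mul_inv (a := M) (by linarith) hr
    (h1 (M - 1) (by linarith)).1
  rw [(h1 (M - 1) (by linarith)).2] at hv2
  have hexp : ∀ x : ℝ, ((M : ℝ) * x⁻¹ - β⁻¹) ^ 2 =
      (M : ℝ) ^ 2 * (x⁻¹ * x⁻¹) - 2 * M * β⁻¹ * x⁻¹ + β⁻¹ ^ 2 := fun x => by ring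
  simp only [hexp]
  have hi3 : Integrable (fun x : ℝ => (M : ℝ) ^ 2 * (x⁻¹ * x⁻¹) - 2 * M * β⁻¹ * x⁻¹)
      (gammaMeasure M (1 / β)) := (hi2.const_mul _).sub (hi1.const_mul _)
  refine ⟨hi3.add (integrable_const _), ?_⟩
  rw [integral_add hi3 (integrable_const _), integral_sub (hi2.const_mul _) (hi1.const_mul _),
    integral_const_mul, integral_const_mul, hv1, hv2, integral_const, probReal_univ, one_smul]
  have : (M : ℝ) - 1 ≠ 0 := by linarith
  have : (M : ℝ) - 2 ≠ 0 := by linarith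
  have : (M : ℝ) - 1 - 1 ≠ 0 := by linarith
  rw [show (M : ℝ) - 2 = M - 1 - 1 by ring]
  field_simp

lemma tendsto_natCast_div_sub (c : ℝ) : Tendsto (fun M : ℕ => (M : ℝ) / (M - c)) atTop (𝓝 1) := by
  have h1 : Tendsto (fun M : ℕ => 1 - c * (M : ℝ)⁻¹) atTop (𝓝 (1 - c * 0)) :=
    tendsto_const_nhds.sub (tendsto_inv_atTop_nhds_zero_nat.const_mul c)
  rw [mul_zero, sub_zero] at h1
  have h2 := h1.inv₀ one_ne_zero
  rw [inv_one] at h2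
  refine h2.congr' ?_
  filter_upwards [eventually_ne_atTop 0] with M hM
  have : (M : ℝ) ≠ 0 := Nat.cast_ne_zero.2 hM
  rw [show 1 - c * (M : ℝ)⁻¹ = (M - c) / M by field_simp, inv_div]

/-- `M / X → 1 / β` in mean for `X` gamma distributed with shape `M` and scale `β`. -/
lemma tendsto_integral_abs_inv_gamma {β : ℝ} (hβ : 0 < β) :
    Tendsto (fun M : ℕ => ∫ x, |(M : ℝ) * x⁻¹ - β⁻¹| ∂gammaMeasure M (1 / β)) atTop (𝓝 0) := by
  have h1 : Tendsto (fun M : ℕ => β⁻¹ ^ 2 * ((M : ℝ) / (M - 1) * (M / (M - 2)) -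
      2 * (M / (M - 1)) + 1)) atTop (𝓝 0) := by
    have := ((((tendsto_natCast_div_sub 1).mul (tendsto_natCast_div_sub 2)).sub
      ((tendsto_natCast_div_sub 1).const_mul 2)).add_const 1).const_mul (β⁻¹ ^ 2)
    convert this using 2
    norm_num
  refine Metric.tendsto_nhds.2 fun ε hε => ?_
  filter_upwards [h1.eventually_lt_const (show 0 < ε ^ 2 / 4 by positivity), eventually_ge_atTop 3]
    with M hM hM3
  obtain ⟨hi, hv⟩ := integral_gammaMeasure_inv_dev hβ hM3
  have : IsProbabilityMeasure (gammaMeasure M (1 / β)) :=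
    isProbabilityMeasure_gammaMeasure (by positivity) (by positivity)
  have hbi : Integrable (fun x => ε / 2 + 2 / ε * ((M : ℝ) * x⁻¹ - β⁻¹) ^ 2)
      (gammaMeasure M (1 / β)) := (integrable_const _).add (hi.const_mul _)
  have hle : ∀ x : ℝ, |(M : ℝ) * x⁻¹ - β⁻¹| ≤ ε / 2 + 2 / ε * ((M : ℝ) * x⁻¹ - β⁻¹) ^ 2 := by
    intro x
    rw [← sq_abs ((M : ℝ) * x⁻¹ - β⁻¹)]
    generalize |(M : ℝ) * x⁻¹ - β⁻¹| = y
    have : ε / 2 + 2 / ε * y ^ 2 - y = 2 / ε * ((y - ε / 4) ^ 2 + 3 * ε ^ 2 / 16) := by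
      field_simp; ring
    have : 0 ≤ 2 / ε * ((y - ε / 4) ^ 2 + 3 * ε ^ 2 / 16) := by positivity
    linarith
  rw [Real.dist_eq, sub_zero, abs_of_nonneg (integral_nonneg fun _ => abs_nonneg _)]
  calc _ ≤ ∫ x, (ε / 2 + 2 / ε * ((M : ℝ) * x⁻¹ - β⁻¹) ^ 2) ∂gammaMeasure M (1 / β) :=
        integral_mono_of_nonneg (ae_of_all _ fun _ => abs_nonneg _) hbi (ae_of_all _ hle)
    _ = ε / 2 + 2 / ε * ∫ x, ((M : ℝ) * x⁻¹ - β⁻¹) ^ 2 ∂gammaMeasure M (1 / β) := by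
      rw [integral_add (integrable_const _) (hi.const_mul _), integral_const_mul, integral_const,
        probReal_univ, one_smul]
    _ < ε / 2 + 2 / ε * (ε ^ 2 / 4) := by
      rw [hv]
      exact add_lt_add_right (mul_lt_mul_of_pos_left hM (by positivity)) _
    _ = ε := by
      have : 2 / ε * (ε ^ 2 / 4) = ε / 2 := by field_simp; norm_num
      rw [this, add_halves]

lemma measurable_orderStat {n : ℕ} (k : Fin n) : Measurable (orderStat k) :=
  measurable_of_finite_choice (o := Tuple.sort) (f := fun π x => x (π k))
    measurableSet_sort_eq fun _ => measurable_pi_apply _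

/-- A nonnegative function of an order statistic is bounded by the sum over the sample. -/
lemma apply_orderStat_le_sum {n : ℕ} (k : Fin n) (x : Fin n → ℝ) {f : ℝ → ℝ} (hf : ∀ y, 0 ≤ f y) :
    f (orderStat k x) ≤ ∑ i, f (x i) :=
  Finset.single_le_sum (f := fun i => f (x i)) (fun _ _ => hf _) (Finset.mem_univ (Tuple.sort x k))

lemma hasPDF_orderStat {n : ℕ} (k : Fin n) {μ : Measure ℝ} [IsProbabilityMeasure μ]
    (hμ : μ ≪ volume) : HasPDF (orderStat k) (Measure.pi fun _ : Fin n => μ) volume := by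
  rw [Real.hasPDF_iff]
  refine ⟨(measurable_orderStat k).aemeasurable, Measure.AbsolutelyContinuous.mk fun s hs h0 => ?_⟩
  rw [Measure.map_apply (measurable_orderStat k) hs]
  refine measure_mono_null (t := ⋃ i, Function.eval i ⁻¹' s)
    (fun x hx => Set.mem_iUnion.2 ⟨Tuple.sort x k, hx⟩) (measure_iUnion_null fun i => ?_)
  rw [(measurePreserving_eval (fun _ : Fin n => μ) i).measure_preimage hs.nullMeasurableSet]
  exact hμ h0

lemma gammaMeasure_Iic_zero (a r : ℝ) : gammaMeasure a r (Set.Iic 0) = 0 := by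
  rw [gammaMeasure, withDensity_apply _ measurableSet_Iic, ← setLIntegral_congr Iio_ae_eq_Iic]
  exact lintegral_gammaPDF_of_nonpos le_rfl

lemma setIntegral_gammaOrderStatPDF_div {β : ℝ} (hβ : 0 < β) {M : ℕ} (hM : M ≠ 0) {n : ℕ}
    (k : Fin n) : ∫ x in Set.Ioi (0 : ℝ), gammaOrderStatPDF M β k x / x =
      ∫ x, (Set.Ioi (0 : ℝ)).indicator (fun y => y⁻¹) (orderStat k x)
        ∂(Measure.pi fun _ : Fin n => gammaMeasure (M : ℝ) (1 / β)) := by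
  have : IsProbabilityMeasure (gammaMeasure M (1 / β)) :=
    isProbabilityMeasure_gammaMeasure (by positivity) (by positivity)
  have := hasPDF_orderStat k (μ := gammaMeasure (M : ℝ) (1 / β))
    (withDensity_absolutelyContinuous _ _)
  rw [← integral_indicator measurableSet_Ioi, ← pdf.integral_pdf_smul (μ := volume)
    ((measurable_inv.indicator measurableSet_Ioi).aestronglyMeasurable)]
  refine integral_congr_ae (ae_of_all _ fun x => ?_)
  by_cases hx : x ∈ Set.Ioi (0 : ℝ)
  · simp only [Set.indicator_of_mem hx, gammaOrderStatPDF, smul_eq_mul, div_eq_mul_inv]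
  · simp only [Set.indicator_of_notMem hx, smul_zero]

lemma tendsto_mul_setIntegral_gammaOrderStatPDF {β : ℝ} (hβ : 0 < β) {n : ℕ} (k : Fin n) :
    Tendsto (fun M : ℕ => (M : ℝ) * ∫ x in Set.Ioi (0 : ℝ), gammaOrderStatPDF M β k x / x) atTop
      (𝓝 β⁻¹) := by
  rw [tendsto_iff_dist_tendsto_zero]
  have hlim := (tendsto_integral_abs_inv_gamma hβ).const_mul (n : ℝ)
  rw [mul_zero] at hlim
  refine squeeze_zero' (Eventually.of_forall fun _ => dist_nonneg) ?_ hlim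
  filter_upwards [eventually_ge_atTop 3] with M hM
  have hM0 : M ≠ 0 := by omega
  have : IsProbabilityMeasure (gammaMeasure M (1 / β)) :=
    isProbabilityMeasure_gammaMeasure (by positivity) (by positivity)
  set γ := gammaMeasure (M : ℝ) (1 / β) with hγ
  set g : ℝ → ℝ := (Set.Ioi (0 : ℝ)).indicator fun y => y⁻¹ with hgdef
  have hgm : Measurable g := measurable_inv.indicator measurableSet_Ioi
  have hae : (fun x => |(M : ℝ) * x⁻¹ - β⁻¹|) =ᵐ[γ] fun x => |(M : ℝ) * g x - β⁻¹| := by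
    have : ∀ᵐ x ∂γ, x ∈ Set.Ioi (0 : ℝ) := by
      rw [ae_iff]
      have h0 : {x : ℝ | ¬ x ∈ Set.Ioi (0 : ℝ)} = Set.Iic 0 := by ext; simp
      rw [h0]
      exact gammaMeasure_Iic_zero _ _
    filter_upwards [this] with x hx
    rw [hgdef, Set.indicator_of_mem hx]
  have hi0 : Integrable (fun x => |(M : ℝ) * x⁻¹ - β⁻¹|) γ := by
    have hmeas : AEStronglyMeasurable (fun x : ℝ => (M : ℝ) * x⁻¹ - β⁻¹) γ := by
      exact ((measurable_inv.const_mul _).sub_const _).aestronglyMeasurable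
    exact (((memLp_two_iff_integrable_sq hmeas).2
      (integral_gammaMeasure_inv_dev hβ hM).1).integrable one_le_two).abs
  have hi : Integrable (fun x => |(M : ℝ) * g x - β⁻¹|) γ := hi0.congr hae
  have hcoord : ∀ i : Fin n, Integrable (fun x : Fin n → ℝ => |(M : ℝ) * g (x i) - β⁻¹|)
      (Measure.pi fun _ => γ) := fun i =>
    (measurePreserving_eval (fun _ : Fin n => γ) i).integrable_comp_of_integrable hi
  have hsum := integrable_finsetSum Finset.univ fun i _ => hcoord i
  have hdom : ∀ x : Fin n → ℝ, ‖(M : ℝ) * g (orderStat k x) - β⁻¹‖ ≤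
      ∑ i, |(M : ℝ) * g (x i) - β⁻¹| := fun x =>
    apply_orderStat_le_sum k x (f := fun y => |(M : ℝ) * g y - β⁻¹|) fun _ => abs_nonneg _
  have hgo : Measurable fun x : Fin n → ℝ => g (orderStat k x) := hgm.comp (measurable_orderStat k)
  have hoi' : Integrable (fun x : Fin n → ℝ => (M : ℝ) * g (orderStat k x) - β⁻¹)
      (Measure.pi fun _ => γ) :=
    hsum.mono' ((hgo.const_mul _).sub_const _).aestronglyMeasurable (ae_of_all _ hdom)
  have hoi : Integrable (fun x : Fin n → ℝ => (M : ℝ) * g (orderStat k x))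
      (Measure.pi fun _ => γ) := by
    refine (hoi'.add (integrable_const β⁻¹)).congr (ae_of_all _ fun x => ?_)
    simp only [Pi.add_apply, sub_add_cancel]
  have hsub : (M : ℝ) * (∫ x in Set.Ioi (0 : ℝ), gammaOrderStatPDF M β k x / x) - β⁻¹ =
      ∫ x : Fin n → ℝ, ((M : ℝ) * g (orderStat k x) - β⁻¹) ∂(Measure.pi fun _ => γ) := by
    rw [setIntegral_gammaOrderStatPDF_div hβ hM0, integral_sub hoi (integrable_const _),
      integral_const_mul]
    rw [integral_const, probReal_univ, one_smul]
  rw [Real.dist_eq, hsub, ← Real.norm_eq_abs]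
  refine (norm_integral_le_of_norm_le hsum (ae_of_all _ hdom)).trans_eq ?_
  rw [integral_finsetSum _ fun i _ => hcoord i, integral_congr_ae hae]
  have := integral_comp_eval (ι := Fin n) hi.aestronglyMeasurable
  simp only [this, Finset.sum_const, Finset.card_univ, Fintype.card_fin, nsmul_eq_mul]

lemma tendsto_mul_orderStatSum {β : ℝ} (hβ : 0 < β) {n m : ℕ} (hmn : m ≤ n) :
    Tendsto (fun M : ℕ => (M : ℝ) * orderStatSum M β n m) atTop (𝓝 (m / β)) := by
  have h := tendsto_finsetSum (Finset.univ.filter fun k : Fin n => (k : ℕ) < m)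
    fun k _ => tendsto_mul_setIntegral_gammaOrderStatPDF hβ k
  rw [Finset.sum_const, Fin.card_filter_val_lt, min_eq_right hmn, nsmul_eq_mul,
    ← div_eq_mul_inv] at h
  refine h.congr fun M => ?_
  rw [orderStatSum, Finset.mul_sum]

/-! ### The closed-form expressions -/

lemma tendsto_logb_sub_logb_natCast {x : ℕ → ℝ} {c : ℝ} (hc : 0 < c)
    (h : Tendsto (fun M : ℕ => x M / M) atTop (𝓝 c)) :
    Tendsto (fun M : ℕ => Real.logb 2 (x M) - Real.logb 2 M) atTop (𝓝 (Real.logb 2 c)) := by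
  have h1 : Tendsto (fun M : ℕ => Real.logb 2 (x M / M)) atTop (𝓝 (Real.logb 2 c)) :=
    ((Real.continuousAt_log hc.ne').tendsto.comp h).div_const _
  refine h1.congr' ?_
  filter_upwards [h.eventually_const_lt hc, eventually_ne_atTop 0] with M hM hM0
  have hM0' : (M : ℝ) ≠ 0 := Nat.cast_ne_zero.2 hM0
  refine Real.logb_div (fun hx => ?_) hM0'
  rw [hx, zero_div] at hM
  exact lt_irrefl _ hM

lemma tendsto_sub_natCast_div (c d : ℝ) :
    Tendsto (fun M : ℕ => ((M : ℝ) - c) / (M - d)) atTop (𝓝 1) := by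
  have h := (tendsto_natCast_div_sub d).div (tendsto_natCast_div_sub c) one_ne_zero
  rw [div_one] at h
  refine h.congr' ?_
  filter_upwards [eventually_ne_atTop 0] with M hM
  have : (M : ℝ) ≠ 0 := Nat.cast_ne_zero.2 hM
  simp only [Pi.div_apply]
  rw [div_div_div_cancel_left' _ _ this]

lemma tendsto_asympRand {KB : ℕ} {β P σ : ℝ} (hKB : 0 < KB) (hβ : 0 < β) (hP : 0 < P)
    (hσ : 0 < σ) : Tendsto (fun M : ℕ => asympRand KB M β P σ - Real.logb 2 M) atTop
      (𝓝 (Real.logb 2 (P * β / (σ ^ 2 * KB)))) := by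
  have hKB' : (0 : ℝ) < KB := Nat.cast_pos.2 hKB
  refine tendsto_logb_sub_logb_natCast (by positivity) ?_
  have h := (tendsto_inv_atTop_nhds_zero_nat (𝕜 := ℝ)).add
    ((tendsto_sub_natCast_div KB 0).const_mul (P * β / (σ ^ 2 * KB)))
  rw [zero_add, mul_one] at h
  refine h.congr fun M => ?_
  rw [sub_zero, add_div, one_div]
  congr 1
  field_simp

lemma tendsto_asympLast {KB : ℕ} {P σ α : ℝ} (hP : 0 < P) (hσ : 0 < σ) (hα : 0 < α) {A : ℕ → ℝ}
    (hA : Tendsto (fun M : ℕ => M * A M) atTop (𝓝 α)) :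
    Tendsto (fun M : ℕ => asympLast KB M P σ (A M) - Real.logb 2 M) atTop
      (𝓝 (Real.logb 2 (P / (σ ^ 2 * α)))) := by
  refine tendsto_logb_sub_logb_natCast (by positivity) ?_
  have h := (tendsto_inv_atTop_nhds_zero_nat (𝕜 := ℝ)).add
    (((tendsto_sub_natCast_div KB 1).mul (hA.inv₀ hα.ne')).const_mul (P / σ ^ 2))
  rw [zero_add, one_mul, ← div_eq_mul_inv, div_div] at h
  refine h.congr fun M => ?_
  rw [add_div, one_div, div_mul_eq_div_div, mul_inv]
  congr 1
  ring

lemma tendsto_asympLast_coeffAcc {T KB : ℕ} {β P σ : ℝ} (hKB : 0 < KB) (hT : 0 < T) (hβ : 0 < β)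
    (hP : 0 < P) (hσ : 0 < σ) :
    Tendsto (fun M : ℕ => asympLast KB M P σ (coeffAcc T KB M β) - Real.logb 2 M) atTop
      (𝓝 (Real.logb 2 (P * β / (σ ^ 2 * KB)))) := by
  have hKB' : (0 : ℝ) < KB := Nat.cast_pos.2 hKB
  have h := tendsto_asympLast (KB := KB) hP hσ (by positivity : 0 < (KB : ℝ) / β)
    (tendsto_mul_orderStatSum hβ (Nat.le_mul_of_pos_left KB hT))
  rwa [show P / (σ ^ 2 * (KB / β)) = P * β / (σ ^ 2 * KB) by field_simp] at h

lemma tendsto_asympLast_coeffMis {T KB KM : ℕ} {β P σ δ : ℝ} (hKB : 0 < KB) (hKM : KM ≤ KB)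
    (hT : 0 < T) (hβ : 0 < β) (hP : 0 < P) (hσ : 0 < σ) (hδ : 0 < δ) :
    Tendsto (fun M : ℕ => asympLast KB M P σ (coeffMis T KB KM M β δ) - Real.logb 2 M) atTop
      (𝓝 (Real.logb 2 (P * β / (σ ^ 2 * (KM / δ + (KB - KM)))))) := by
  have hKM' : (KM : ℝ) ≤ KB := Nat.cast_le.2 hKM
  have hpos : 0 < (KM : ℝ) / δ + (KB - KM) := by
    rcases hKM'.eq_or_lt with h | h
    · have : (0 : ℝ) < KM := h ▸ Nat.cast_pos.2 hKB
      rw [h, sub_self, ← h]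
      positivity
    · have := sub_pos.2 h
      positivity
  have h1 := (tendsto_natCast_div_sub 1).const_mul ((KM : ℝ) / (δ * β))
  have h2 := tendsto_mul_orderStatSum hβ
    (Nat.sub_le_sub_right (Nat.le_mul_of_pos_left KB hT) KM)
  have h3 := h1.add h2
  have hlim : (KM : ℝ) / (δ * β) * 1 + ((KB - KM : ℕ) : ℝ) / β = (KM / δ + (KB - KM)) / β := by
    rw [Nat.cast_sub hKM]
    field_simp
  rw [hlim] at h3
  have h := tendsto_asympLast (KB := KB) (A := fun M => coeffMis T KB KM M β δ) hP hσ
    (by positivity : 0 < ((KM : ℝ) / δ + (KB - KM)) / β) (h3.congr fun M => by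
      rw [coeffMis, mul_add, div_mul_div_comm, mul_div_assoc', mul_comm (KM : ℝ)])
  rwa [show P / (σ ^ 2 * (((KM : ℝ) / δ + (KB - KM)) / β)) =
    P * β / (σ ^ 2 * (KM / δ + (KB - KM))) by field_simp] at h

/-! ### The rate loss -/

lemma tendsto_div_of_tendsto_sub {ι : Type*} {u : Filter ι} {l r : ι → ℝ} {c : ℝ}
    (hl : Tendsto l u atTop) (h : Tendsto (fun i => r i - l i) u (𝓝 c)) :
    Tendsto (fun i => l i / r i) u (𝓝 1) := by
  have h1 : Tendsto (fun i => 1 + (r i - l i) / l i) u (𝓝 (1 + 0)) :=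
    tendsto_const_nhds.add (h.div_atTop hl)
  rw [add_zero] at h1
  have h2 := h1.inv₀ one_ne_zero
  rw [inv_one] at h2
  refine h2.congr' ?_
  filter_upwards [hl.eventually_gt_atTop 0] with i hi
  rw [← inv_div (r i), _root_.inv_inj, sub_div, div_self hi.ne', add_sub_cancel]

/-- The coefficients of `lossForm` sum to zero, so only rate differences enter. -/
lemma lossForm_eq {T KB KM : ℕ} (hT : 0 < T) (hK : KM < T * KB) {r : ℝ} (hr : r ≠ 0) (a m : ℝ) :
    lossForm T KB KM r a m =
      ((a - r) / T - ((KB : ℝ) - KM) * (m - r) / (((T * KB : ℕ) : ℝ) - KM)) / r := by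
  have hT' : (T : ℝ) ≠ 0 := Nat.cast_ne_zero.2 hT.ne'
  have hK' : ((T * KB : ℕ) : ℝ) - KM ≠ 0 := (sub_pos.2 (Nat.cast_lt.2 hK)).ne'
  rw [lossForm]
  push_cast at hK' ⊢
  field_simp
  ring

lemma tendsto_mul_lossForm {T KB KM : ℕ} (hT : 0 < T) (hK : KM < T * KB) {l r a m : ℕ → ℝ}
    {c d : ℝ} (hl : Tendsto l atTop atTop) (hr : Tendsto (fun M => r M - l M) atTop (𝓝 c))
    (ha : Tendsto (fun M => a M - l M) atTop (𝓝 c))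
    (hm : Tendsto (fun M => ((KB : ℝ) - KM) * (m M - l M)) atTop (𝓝 (((KB : ℝ) - KM) * d))) :
    Tendsto (fun M => l M * lossForm T KB KM (r M) (a M) (m M)) atTop
      (𝓝 (((KB : ℝ) - KM) * (c - d) / (((T * KB : ℕ) : ℝ) - KM))) := by
  have hr0 : ∀ᶠ M in atTop, r M ≠ 0 := by
    have : Tendsto r atTop atTop := by
      have := hr.add_atTop hl
      exact this.congr fun M => sub_add_cancel _ _
    exact this.eventually_ne_atTop 0
  have h1 := (tendsto_div_of_tendsto_sub hl hr).mul (((ha.sub hr).div_const (T : ℝ)).sub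
    ((hm.sub (hr.const_mul ((KB : ℝ) - KM))).div_const (((T * KB : ℕ) : ℝ) - KM)))
  have hlim : 1 * ((c - c) / (T : ℝ) - (((KB : ℝ) - KM) * d - ((KB : ℝ) - KM) * c) /
      (((T * KB : ℕ) : ℝ) - KM)) = ((KB : ℝ) - KM) * (c - d) / (((T * KB : ℕ) : ℝ) - KM) := by
    ring
  rw [hlim] at h1
  refine h1.congr' ?_
  filter_upwards [hr0] with M hM
  rw [lossForm_eq hT hK hM]
  ring

lemma tendsto_period_average {T KB : ℕ} (hT : 0 < T) (hKB : 0 < KB) {l : ℕ → ℝ}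
    {R : Fin T → ℕ → ℝ} {c : ℝ} (h : ∀ t, Tendsto (fun M => R t M - l M) atTop (𝓝 c)) :
    Tendsto (fun M => 1 / ((T * KB : ℕ) : ℝ) * ∑ t, (KB : ℝ) * R t M - l M) atTop (𝓝 c) := by
  have hT' : (T : ℝ) ≠ 0 := Nat.cast_ne_zero.2 hT.ne'
  have hKB' : (KB : ℝ) ≠ 0 := Nat.cast_ne_zero.2 hKB.ne'
  have h1 := (tendsto_finsetSum Finset.univ fun t _ => h t).const_mul (1 / (T : ℝ))
  rw [Finset.sum_const, Finset.card_univ, Fintype.card_fin, nsmul_eq_mul, one_div,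
    inv_mul_cancel_left₀ hT'] at h1
  refine h1.congr fun M => ?_
  rw [Finset.sum_sub_distrib, Finset.sum_const, Finset.card_univ, Fintype.card_fin, nsmul_eq_mul,
    ← Finset.mul_sum, mul_sub, inv_mul_cancel_left₀ hT']
  push_cast
  field_simp

lemma tendsto_periodRateMisCM {T KB KM : ℕ} [NeZero T] {β P σ δ c d : ℝ} (hK : KM < T * KB)
    {l : ℕ → ℝ}
    (hc : ∀ t ≠ (⊤ : Fin T), Tendsto (fun M => rateMisCM T KB KM M β P σ δ t - l M) atTop (𝓝 c))
    (hd : Tendsto (fun M => ((KB : ℝ) - KM) * (rateMisCM T KB KM M β P σ δ ⊤ - l M)) atTop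
      (𝓝 (((KB : ℝ) - KM) * d))) :
    Tendsto (fun M => periodRateMisCM T KB KM M β P σ δ - l M) atTop
      (𝓝 (c - ((KB : ℝ) - KM) * (c - d) / (((T * KB : ℕ) : ℝ) - KM))) := by
  have hK' : ((T * KB : ℕ) : ℝ) - KM ≠ 0 := (sub_pos.2 (Nat.cast_lt.2 hK)).ne'
  have hcard : ∀ x : ℝ, ∑ _t ∈ Finset.univ.erase (⊤ : Fin T), x = (T - 1) * x := fun x => by
    rw [Finset.sum_const, Finset.card_erase_of_mem (Finset.mem_univ _), Finset.card_univ,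
      Fintype.card_fin, nsmul_eq_mul, Nat.cast_sub (Nat.pos_of_ne_zero (NeZero.ne T)), Nat.cast_one]
  have h1 := tendsto_finsetSum (Finset.univ.erase (⊤ : Fin T)) fun t ht =>
    (hc t (Finset.ne_of_mem_erase ht)).const_mul (KB : ℝ)
  have h2 := (hd.add h1).div_const (((T * KB : ℕ) : ℝ) - KM)
  have hlim : (((KB : ℝ) - KM) * d + ∑ _t ∈ Finset.univ.erase (⊤ : Fin T), (KB : ℝ) * c) /
      (((T * KB : ℕ) : ℝ) - KM) = c - ((KB : ℝ) - KM) * (c - d) / (((T * KB : ℕ) : ℝ) - KM) := by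
    rw [hcard, eq_sub_iff_add_eq, ← add_div, div_eq_iff hK']
    push_cast
    ring
  rw [hlim] at h2
  refine h2.congr fun M => ?_
  rw [periodRateMisCM, eq_sub_iff_add_eq, div_add' _ _ _ hK']
  congr 1
  simp only [mul_sub, Finset.sum_sub_distrib, hcard]
  push_cast
  ring

/-- Two rates growing like `l` with offsets differing by `k` have relative difference `k / l` to
first order. -/
lemma tendsto_mul_rateLoss {l a m : ℕ → ℝ} {c k : ℝ} (hl : Tendsto l atTop atTop)
    (ha : Tendsto (fun M => a M - l M) atTop (𝓝 c))
    (hm : Tendsto (fun M => m M - l M) atTop (𝓝 (c - k))) :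
    Tendsto (fun M => l M * ((a M - m M) / a M)) atTop (𝓝 k) := by
  have h := (tendsto_div_of_tendsto_sub hl ha).mul (ha.sub hm)
  rw [one_mul, sub_sub_cancel] at h
  refine h.congr fun M => ?_
  ring

lemma tendsto_sub_of_tendsto_mul {l x y : ℕ → ℝ} {k : ℝ} (hl : Tendsto l atTop atTop)
    (hx : Tendsto (fun M => l M * x M) atTop (𝓝 k))
    (hy : Tendsto (fun M => l M * y M) atTop (𝓝 k)) :
    Tendsto (fun M => x M - y M) atTop (𝓝 0) := by
  refine ((hx.sub hy).div_atTop hl).congr' ?_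
  filter_upwards [hl.eventually_gt_atTop 0] with M hM
  rw [← mul_sub, mul_div_cancel_left₀ _ hM.ne']

lemma isEquivalent_of_tendsto_mul {l x y : ℕ → ℝ} {k : ℝ} (hl : Tendsto l atTop atTop)
    (hk : k ≠ 0) (hx : Tendsto (fun M => l M * x M) atTop (𝓝 k))
    (hy : Tendsto (fun M => l M * y M) atTop (𝓝 k)) : x ~[atTop] y := by
  have hy0 : ∀ᶠ M in atTop, y M ≠ 0 := by
    filter_upwards [hy.eventually_ne hk] with M hM h0
    exact hM (by rw [h0, mul_zero])
  rw [isEquivalent_iff_tendsto_one hy0]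
  have h := hx.div hy hk
  rw [div_self hk] at h
  refine h.congr' ?_
  filter_upwards [hl.eventually_gt_atTop 0] with M hM
  simp only [Pi.div_apply]
  exact mul_div_mul_left _ _ hM.ne'

lemma logb_sub_logb_ne_zero {KB KM : ℕ} {β P σ δ : ℝ} (hKB : 0 < KB) (hKM : 1 ≤ KM)
    (hβ : 0 < β) (hP : 0 < P) (hσ : 0 < σ) (hδ0 : 0 < δ) (hδ1 : δ < 1) :
    Real.logb 2 (P * β / (σ ^ 2 * KB)) -
      Real.logb 2 (P * β / (σ ^ 2 * (KM / δ + (KB - KM)))) ≠ 0 := by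
  have hKB' : (0 : ℝ) < KB := Nat.cast_pos.2 hKB
  have hKM' : (0 : ℝ) < KM := Nat.cast_pos.2 hKM
  have h1 : (KM : ℝ) < KM / δ := (lt_div_iff₀ hδ0).2 (mul_lt_of_lt_one_right hKM' hδ1)
  have h2 : (KB : ℝ) < KM / δ + (KB - KM) := by linarith
  have h3 : 0 < (KM : ℝ) / δ + (KB - KM) := hKB'.trans h2
  refine (sub_pos.2 (Real.logb_lt_logb one_lt_two (by positivity) ?_)).ne'
  gcongr

end MassiveMIMO

end

theorem proposition3 (T KB KM : ℕ) [NeZero T] (hKB : 0 < KB) (hKM : KM ≤ KB)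
    (hK : KM < T * KB) (β P σ δ : ℝ) (hβ : 0 < β) (hP : 0 < P) (hσ : 0 < σ)
    (hδ0 : 0 < δ) (hδ1 : δ < 1) :
    -- the asymptotic form of the rate loss, in terms of the rates themselves
    Tendsto (fun M : ℕ => MassiveMIMO.rateLossCM T KB KM M β P σ δ -
        MassiveMIMO.lossForm T KB KM (MassiveMIMO.rateAccRand T KB M β P σ)
          (MassiveMIMO.rateAccCM T KB M β P σ ⊤) (MassiveMIMO.rateMisCM T KB KM M β P σ δ ⊤))
      atTop (𝓝 0) ∧
    -- the same with the asymptotic expressions of the rates inserted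
    Tendsto (fun M : ℕ => MassiveMIMO.rateLossCM T KB KM M β P σ δ -
        MassiveMIMO.lossForm T KB KM (MassiveMIMO.asympRand KB M β P σ)
          (MassiveMIMO.asympLast KB M P σ (MassiveMIMO.coeffAcc T KB M β))
          (MassiveMIMO.asympLast KB M P σ (MassiveMIMO.coeffMis T KB KM M β δ)))
      atTop (𝓝 0) ∧
    -- both hold with vanishing relative error (the rate loss itself tends to zero)
    (1 ≤ KM → KM < KB →
      (fun M : ℕ => MassiveMIMO.rateLossCM T KB KM M β P σ δ) ~[atTop]
        (fun M : ℕ => MassiveMIMO.lossForm T KB KM (MassiveMIMO.rateAccRand T KB M β P σ)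
          (MassiveMIMO.rateAccCM T KB M β P σ ⊤) (MassiveMIMO.rateMisCM T KB KM M β P σ δ ⊤)) ∧
      (fun M : ℕ => MassiveMIMO.rateLossCM T KB KM M β P σ δ) ~[atTop]
        (fun M : ℕ => MassiveMIMO.lossForm T KB KM (MassiveMIMO.asympRand KB M β P σ)
          (MassiveMIMO.asympLast KB M P σ (MassiveMIMO.coeffAcc T KB M β))
          (MassiveMIMO.asympLast KB M P σ (MassiveMIMO.coeffMis T KB KM M β δ)))) ∧
    -- the asymptotic expressions of the three rates
    Tendsto (fun M : ℕ => MassiveMIMO.rateAccRand T KB M β P σ -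
        MassiveMIMO.asympRand KB M β P σ) atTop (𝓝 0) ∧
    Tendsto (fun M : ℕ => MassiveMIMO.rateAccCM T KB M β P σ ⊤ -
        MassiveMIMO.asympLast KB M P σ (MassiveMIMO.coeffAcc T KB M β)) atTop (𝓝 0) ∧
    (KM < KB →
      Tendsto (fun M : ℕ => MassiveMIMO.rateMisCM T KB KM M β P σ δ ⊤ -
        MassiveMIMO.asympLast KB M P σ (MassiveMIMO.coeffMis T KB KM M β δ)) atTop (𝓝 0)) := by
  have hT : 0 < T := Nat.pos_of_ne_zero (NeZero.ne T)
  have hl := MassiveMIMO.tendsto_logb_natCast_atTop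
  set c := Real.logb 2 (P * β / (σ ^ 2 * KB))
  set d := Real.logb 2 (P * β / (σ ^ 2 * (KM / δ + (KB - KM))))
  have hrand := MassiveMIMO.tendsto_period_average hT hKB fun t : Fin T =>
    MassiveMIMO.tendsto_rateAccRandBlock hKB hβ hP hσ t
  have hacc := fun t : Fin T => MassiveMIMO.tendsto_rateAccCM hKB hβ hP hσ t
  have hmis : KM < KB → _ := fun h =>
    MassiveMIMO.tendsto_rateMisCM_top (T := T) h hβ hP hσ hδ0 hδ1
  have hRand := MassiveMIMO.tendsto_asympRand hKB hβ hP hσ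
  have hAcc := MassiveMIMO.tendsto_asympLast_coeffAcc hKB hT hβ hP hσ
  have hMis := MassiveMIMO.tendsto_asympLast_coeffMis hKB hKM hT hβ hP hσ hδ0
  -- for `KM = KB` nothing is known about the rate in the last block, but its weight vanishes
  have hmis' : Tendsto (fun M : ℕ => ((KB : ℝ) - KM) *
      (MassiveMIMO.rateMisCM T KB KM M β P σ δ ⊤ - Real.logb 2 M)) atTop
      (𝓝 (((KB : ℝ) - KM) * d)) := by
    rcases hKM.eq_or_lt with rfl | h
    · simp
    · exact (hmis h).const_mul _
  have hloss := MassiveMIMO.tendsto_mul_rateLoss hl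
    (MassiveMIMO.tendsto_period_average hT hKB hacc)
    (MassiveMIMO.tendsto_periodRateMisCM hK
      (fun t ht => MassiveMIMO.tendsto_rateMisCM_of_ne_top hKB hKM hβ hP hσ hδ0 hδ1 ht) hmis')
  have hform₁ := MassiveMIMO.tendsto_mul_lossForm hT hK hl hrand (hacc ⊤) hmis'
  have hform₂ := MassiveMIMO.tendsto_mul_lossForm hT hK hl hRand hAcc (hMis.const_mul _)
  have hsub : ∀ {u v : ℕ → ℝ} {e : ℝ}, Tendsto (fun M : ℕ => u M - Real.logb 2 M) atTop (𝓝 e) →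
      Tendsto (fun M : ℕ => v M - Real.logb 2 M) atTop (𝓝 e) →
      Tendsto (fun M => u M - v M) atTop (𝓝 0) := fun hu hv => by
    have := hu.sub hv
    rw [sub_self] at this
    exact this.congr fun M => sub_sub_sub_cancel_right _ _ _
  refine ⟨MassiveMIMO.tendsto_sub_of_tendsto_mul hl hloss hform₁,
    MassiveMIMO.tendsto_sub_of_tendsto_mul hl hloss hform₂, fun h1 h2 => ?_, hsub hrand hRand,
    hsub (hacc ⊤) hAcc, fun h => hsub (hmis h) hMis⟩
  have hk : ((KB : ℝ) - KM) * (c - d) / (((T * KB : ℕ) : ℝ) - KM) ≠ 0 :=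
    div_ne_zero (mul_ne_zero (sub_pos.2 (Nat.cast_lt.2 h2)).ne'
      (MassiveMIMO.logb_sub_logb_ne_zero hKB h1 hβ hP hσ hδ0 hδ1))
      (sub_pos.2 (Nat.cast_lt.2 hK)).ne'
  exact ⟨MassiveMIMO.isEquivalent_of_tendsto_mul hl hk hloss hform₁,
    MassiveMIMO.isEquivalent_of_tendsto_mul hl hk hloss hform₂⟩
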